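/- Let $d\in\mathbb{N}$ and let $\mathcal{L}^{\infty}$ be the Banach space of bounded sequences $A=(A(n))_{n\in\mathbb{N}}$ of real $d\times d$ matrices, $\mathbb{N}=\{0,1,2,\dots\}$, with norm $\|A\|_\infty=\sup_{n}\|A(n)\|$, where $\|\cdot\|$ is the spectral norm. Let $\mathcal{L}^{\mathrm{Lya}}\subseteq\mathcal{L}^\infty$ be the space of Lyapunov sequences, i.e. of those $A\in\mathcal{L}^\infty$ for which every $A(n)$ is invertible and $(A(n)^{-1})_{n\in\mathbb{N}}$ is bounded, with the metric induced by $\|\cdot\|_\infty$. For $x_0\in\mathbb{R}^d$ let $(x(n,x_0))_{n\in\mathbb{N}}$ be the solution of $x(n+1)=A(n)x(n)$ with $x(0,x_0)=x_0$. The system $x(n+1)=A(n)x(n)$ has an exponential dichotomy if there are subspaces $L_1,L_2$ with $\mathbb{R}^d=L_1\oplus L_2$ and constants $\alpha>0$, $K>0$ such that, for all $n\ge m$ in $\mathbb{N}$, $$\|x(n,x_0)\|\le K e^{-\alpha(n-m)}\|x(m,x_0)\|\quad (x_0\in L_1),\qquad \|x(n,x_0)\|\ge K^{-1}e^{\alpha(n-m)}\|x(m,x_0)\|\quad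 (x_0\in L_2).$$ It has a Bohl dichotomy if there are subspaces $L_1,L_2$ with $\mathbb{R}^d=L_1\oplus L_2$, a constant $\alpha>0$ and functions $C_1,C_2\colon\mathbb{R}^d\to(0,\infty)$ such that, for all $n\ge m$ in $\mathbb{N}$, $$\|x(n,x_0)\|\le C_1(x_0)e^{-\alpha(n-m)}\|x(m,x_0)\|\quad (x_0\in L_1),\qquad \|x(n,x_0)\|\ge C_2(x_0)e^{\alpha(n-m)}\|x(m,x_0)\|\quad (x_0\in L_2).$$ Let $\mathrm{ED}^d$ and $\mathrm{BD}^d$ be the sets of all $A\in\mathcal{L}^{\mathrm{Lya}}$ whose system has an exponential dichotomy and a Bohl dichotomy, respectively. Theorem. $\operatorname{int}\mathrm{BD}^d=\mathrm{ED}^d$, where the interior may be taken in $\mathcal{L}^{\mathrm{Lya}}$ or in $\mathcal{L}^\infty$. Moreover, for every $A\in\mathrm{BD}^d\setminus\mathrm{ED}^d$ and every $\varepsilon>0$ there is a $B\in\mathcal{L}^{\mathrm{Lya}}$ with $\|B-A\|_\infty<\varepsilon$ and $B\notin\mathrm{BD}^d$. -/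

import Mathlib

open Set
open scoped ENNReal Matrix Matrix.Norms.L2Operator

/-- The Banach space of bounded sequences of real `d × d` matrices, with the norm
`‖A‖ = sup_n ‖A n‖`, where matrices carry the spectral norm (the operator norm induced by the
Euclidean norm on `ℝ^d`). -/
abbrev BddMatSeq (d : ℕ) : Type :=
  lp (fun _ : ℕ => Matrix (Fin d) (Fin d) ℝ) ∞

/-- Lyapunov sequences: bounded sequences of invertible matrices whose inverses are bounded. -/
def lyapunovSet (d : ℕ) : Set (BddMatSeq d) :=
  {A | (∀ n, IsUnit (A n)) ∧ Memℓp (fun n => (A n)⁻¹) ∞}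

/-- The space of Lyapunov sequences, a metric subspace of the space of bounded sequences. -/
abbrev LyapunovSeq (d : ℕ) : Type :=
  lyapunovSet d

/-- The solution `(x(n, x₀))_n` of `x(n+1) = A(n) x(n)` with `x(0) = x₀`. -/
def solution {d : ℕ} (A : ℕ → Matrix (Fin d) (Fin d) ℝ) (x₀ : EuclideanSpace ℝ (Fin d)) :
    ℕ → EuclideanSpace ℝ (Fin d)
  | 0 => x₀
  | n + 1 => WithLp.toLp 2 (A n *ᵥ (solution A x₀ n).ofLp)

/-- The system `x(n+1) = A(n) x(n)` has an exponential dichotomy. -/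
def HasExponentialDichotomy {d : ℕ} (A : ℕ → Matrix (Fin d) (Fin d) ℝ) : Prop :=
  ∃ L₁ L₂ : Submodule ℝ (EuclideanSpace ℝ (Fin d)), IsCompl L₁ L₂ ∧
    ∃ α K : ℝ, 0 < α ∧ 0 < K ∧
      (∀ x₀ ∈ L₁, ∀ m n : ℕ, m ≤ n →
        ‖solution A x₀ n‖ ≤ K * Real.exp (-α * ((n : ℝ) - (m : ℝ))) * ‖solution A x₀ m‖) ∧
      (∀ x₀ ∈ L₂, ∀ m n : ℕ, m ≤ n →
        K⁻¹ * Real.exp (α * ((n : ℝ) - (m : ℝ))) * ‖solution A x₀ m‖ ≤ ‖solution A x₀ n‖)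

/-- The system `x(n+1) = A(n) x(n)` has a Bohl dichotomy: the rate `α` is uniform, but the
constants may depend on the initial value. -/
def HasBohlDichotomy {d : ℕ} (A : ℕ → Matrix (Fin d) (Fin d) ℝ) : Prop :=
  ∃ L₁ L₂ : Submodule ℝ (EuclideanSpace ℝ (Fin d)), IsCompl L₁ L₂ ∧
    ∃ α : ℝ, 0 < α ∧ ∃ C₁ C₂ : EuclideanSpace ℝ (Fin d) → ℝ,
      (∀ x, 0 < C₁ x) ∧ (∀ x, 0 < C₂ x) ∧
      (∀ x₀ ∈ L₁, ∀ m n : ℕ, m ≤ n →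
        ‖solution A x₀ n‖ ≤ C₁ x₀ * Real.exp (-α * ((n : ℝ) - (m : ℝ))) * ‖solution A x₀ m‖) ∧
      (∀ x₀ ∈ L₂, ∀ m n : ℕ, m ≤ n →
        C₂ x₀ * Real.exp (α * ((n : ℝ) - (m : ℝ))) * ‖solution A x₀ m‖ ≤ ‖solution A x₀ n‖)

/-- The set `ED^d` of Lyapunov sequences whose system has an exponential dichotomy. -/
def ED (d : ℕ) : Set (LyapunovSeq d) :=
  {A | HasExponentialDichotomy (fun n => A.1 n)}

/-- The set `BD^d` of Lyapunov sequences whose system has a Bohl dichotomy. -/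
def BD (d : ℕ) : Set (LyapunovSeq d) :=
  {A | HasBohlDichotomy (fun n => A.1 n)}

/-! Two facts carry the theorem: an exponential dichotomy survives small perturbations, and a Bohl
dichotomy that is not exponential can be destroyed by arbitrarily small ones.

Openness (`IsTempered.exists_roughness`): sum, over a window of `T` steps, the norm of the stable
part minus the norm of the unstable part. This is a Lipschitz function of the state that drops along
orbits by a fixed multiple of the norm, so it still drops along orbits of a nearby system. Orbits on
which it stays nonnegative decay, and orbits on which it becomes negative grow exponentially.

Destruction (`exists_not_hasBohlDichotomy`): if the dichotomy is not exponential, uniformity fails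
on `L₁` or on `L₂`, so that subspace contains orbits violating every two-time estimate, at
arbitrarily late times. A single orbit of a perturbed system is made to inherit all these violations
by small kicks along the violating vectors. Between kicks it is left alone long enough to become
small (case `L₁`) or large (case `L₂`), as every orbit of the subspace must. The result neither
decays nor grows uniformly, which `HasBohlDichotomy.decay_or_growth` forbids.

The kicked orbit is written as `Φ n (ξ n)`, where `ξ` is constant except at kicks. For `L₂` the
kicks must be chosen from the last to the first, so infinitely many come from compactness
(`IsQuasiConstant.exists_forall_mem`). `IsQuasiConstant.exists_bddMatSeq` realizes the orbit by
rank-one changes of the matrices. -/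

/-! ### Tempered evolutions and quasi-constant sequences. -/

section Quasi

variable {E : Type*} [NormedAddCommGroup E] [NormedSpace ℝ E]

/-- A sequence of linear maps starting at the identity, along which the norm of the image of
every vector changes at most by the factor `M` in one step, in both directions. -/
structure IsTempered (Φ : ℕ → E →L[ℝ] E) (M : ℝ) : Prop where
  zero : Φ 0 = ContinuousLinearMap.id ℝ E
  one_le : 1 ≤ M
  up : ∀ n x, ‖Φ (n + 1) x‖ ≤ M * ‖Φ n x‖
  low : ∀ n x, ‖Φ n x‖ ≤ M * ‖Φ (n + 1) x‖

namespace IsTempered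

variable {Φ : ℕ → E →L[ℝ] E} {M : ℝ}

lemma up_add (h : IsTempered Φ M) (n k : ℕ) (x : E) : ‖Φ (n + k) x‖ ≤ M ^ k * ‖Φ n x‖ := by
  have hM := h.one_le
  induction k with
  | zero => simp
  | succ k ih =>
    calc ‖Φ (n + k + 1) x‖ ≤ M * ‖Φ (n + k) x‖ := h.up _ _
      _ ≤ M * (M ^ k * ‖Φ n x‖) := by gcongr
      _ = M ^ (k + 1) * ‖Φ n x‖ := by ring

lemma low_add (h : IsTempered Φ M) (n k : ℕ) (x : E) : ‖Φ n x‖ ≤ M ^ k * ‖Φ (n + k) x‖ := by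
  have hM := h.one_le
  induction k with
  | zero => simp
  | succ k ih =>
    calc ‖Φ n x‖ ≤ M ^ k * ‖Φ (n + k) x‖ := ih
      _ ≤ M ^ k * (M * ‖Φ (n + k + 1) x‖) := by gcongr; exact h.low _ _
      _ = M ^ (k + 1) * ‖Φ (n + (k + 1)) x‖ := by rw [add_assoc]; ring

lemma norm_le (h : IsTempered Φ M) (n : ℕ) (x : E) : ‖x‖ ≤ M ^ n * ‖Φ n x‖ := by
  simpa [h.zero] using h.low_add 0 n x

lemma norm_pos (h : IsTempered Φ M) (n : ℕ) {x : E} (hx : x ≠ 0) : 0 < ‖Φ n x‖ := by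
  rw [norm_pos_iff]
  intro h0
  have := h.norm_le n x
  rw [h0, norm_zero, mul_zero] at this
  exact hx (norm_le_zero_iff.1 this)

/-- A violation of a two-time estimate with a large constant can be moved to late times. -/
lemma late_violation (h : IsTempered Φ M) {K δ : ℝ} (hK : 0 < K) (hδ : 0 < δ) (N : ℕ)
    {a b : ℕ} {x : E}
    (hx : K * (M ^ N * M ^ N * Real.exp (δ * N)) * Real.exp (-δ * |(a : ℝ) - b|) * ‖Φ a x‖
      < ‖Φ b x‖) :
    K * Real.exp (-δ * |((max a N : ℕ) : ℝ) - (max b N : ℕ)|) * ‖Φ (max a N) x‖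
      < ‖Φ (max b N) x‖ := by
  have hM := h.one_le
  have hMN : 0 < M ^ N := by positivity
  have h1 : ‖Φ (max a N) x‖ ≤ M ^ N * ‖Φ a x‖ := by
    have e : max a N = a + (max a N - a) := by omega
    rw [e]
    refine (h.up_add _ _ _).trans ?_
    gcongr
    omega
  have h2 : ‖Φ b x‖ ≤ M ^ N * ‖Φ (max b N) x‖ := by
    have e : max b N = b + (max b N - b) := by omega
    refine (h.low_add b (max b N - b) x).trans ?_
    rw [← e]
    gcongr
    omega
  -- Clipping both times at `N` shortens their distance by at most `N`.
  have h3 : Real.exp (-δ * |((max a N : ℕ) : ℝ) - (max b N : ℕ)|)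
      ≤ Real.exp (δ * N) * Real.exp (-δ * |(a : ℝ) - b|) := by
    rw [← Real.exp_add]
    apply Real.exp_le_exp.2
    have : |(a : ℝ) - b| ≤ |((max a N : ℕ) : ℝ) - (max b N : ℕ)| + N := by
      have hZ : |(a : ℤ) - b| ≤ |((max a N : ℕ) : ℤ) - (max b N : ℕ)| + N := by
        rw [abs_le]
        rcases abs_cases (((max a N : ℕ) : ℤ) - (max b N : ℕ)) with hh | hh <;>
          constructor <;> omega
      exact_mod_cast hZ
    nlinarith
  refine lt_of_mul_lt_mul_left (a := M ^ N) ?_ hMN.le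
  calc M ^ N * (K * Real.exp (-δ * |((max a N : ℕ) : ℝ) - (max b N : ℕ)|) * ‖Φ (max a N) x‖)
      ≤ M ^ N * (K * (Real.exp (δ * N) * Real.exp (-δ * |(a : ℝ) - b|)) * (M ^ N * ‖Φ a x‖)) := by
        gcongr
    _ = K * (M ^ N * M ^ N * Real.exp (δ * N)) * Real.exp (-δ * |(a : ℝ) - b|) * ‖Φ a x‖ := by
        ring
    _ < ‖Φ b x‖ := hx
    _ ≤ _ := h2

end IsTempered

/-- A sequence which is nearly constant when seen through the maps `Φ n`; then `Φ n (ξ n)` is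
nearly an orbit. -/
def IsQuasiConstant (Φ : ℕ → E →L[ℝ] E) (ε : ℝ) (ξ : ℕ → E) : Prop :=
  ∀ n, ‖Φ n (ξ (n + 1) - ξ n)‖ ≤ ε * ‖Φ n (ξ n)‖

namespace IsQuasiConstant

variable {Φ : ℕ → E →L[ℝ] E} {M ε : ℝ} {ξ : ℕ → E}

/-- Each step costs a factor `M` for the map and at most 2 for the change of `ξ`. -/
lemma le_pow_mul (h : IsTempered Φ M) (hε : ε ≤ 1 / 2) (hξ : IsQuasiConstant Φ ε ξ) (n : ℕ) :
    ‖Φ n (ξ n)‖ ≤ (2 * M) ^ n * ‖ξ 0‖ := by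
  have hM := h.one_le
  induction n with
  | zero => simp [h.zero]
  | succ n ih =>
    have h1 : ‖Φ n (ξ (n + 1))‖ ≤ 2 * ‖Φ n (ξ n)‖ := by
      have := norm_add_le (Φ n (ξ (n + 1) - ξ n)) (Φ n (ξ n))
      rw [← map_add, sub_add_cancel] at this
      nlinarith [hξ n, norm_nonneg (Φ n (ξ n))]
    calc ‖Φ (n + 1) (ξ (n + 1))‖ ≤ M * ‖Φ n (ξ (n + 1))‖ := h.up _ _
      _ ≤ M * (2 * ((2 * M) ^ n * ‖ξ 0‖)) := by gcongr; linarith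
      _ = _ := by ring

/-- Since `ε ≤ 1 / 2`, a change of `ξ` at most halves the norm. In particular the kicked orbit never
vanishes. -/
lemma norm_le_pow_mul (h : IsTempered Φ M) (hε : ε ≤ 1 / 2) (hξ : IsQuasiConstant Φ ε ξ) (n : ℕ) :
    ‖ξ 0‖ ≤ (2 * M) ^ n * ‖Φ n (ξ n)‖ := by
  have hM := h.one_le
  induction n with
  | zero => simp [h.zero]
  | succ n ih =>
    have h1 : ‖Φ n (ξ n)‖ ≤ 2 * ‖Φ n (ξ (n + 1))‖ := by
      have := norm_sub_le (Φ n (ξ (n + 1))) (Φ n (ξ (n + 1) - ξ n))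
      rw [← map_sub, sub_sub_cancel] at this
      nlinarith [hξ n, norm_nonneg (Φ n (ξ n))]
    calc ‖ξ 0‖ ≤ (2 * M) ^ n * ‖Φ n (ξ n)‖ := ih
      _ ≤ (2 * M) ^ n * (2 * (M * ‖Φ (n + 1) (ξ (n + 1))‖)) := by
        gcongr
        exact h1.trans (by gcongr; exact h.low _ _)
      _ = _ := by ring

lemma smul (hξ : IsQuasiConstant Φ ε ξ) (c : ℝ) : IsQuasiConstant Φ ε (c • ξ) := by
  intro n
  have := hξ n
  simp only [Pi.smul_apply, ← smul_sub, map_smul, norm_smul]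
  nlinarith [norm_nonneg c, mul_le_mul_of_nonneg_left this (norm_nonneg c)]

/-- Redirecting a quasi-constant sequence to a constant after time `a`. -/
lemma ite (hε : 0 ≤ ε) (hξ : IsQuasiConstant Φ ε ξ) (a : ℕ) {z : E}
    (hz : ‖Φ a (z - ξ a)‖ ≤ ε * ‖Φ a (ξ a)‖) :
    IsQuasiConstant Φ ε (fun n => if n ≤ a then ξ n else z) := by
  intro n
  rcases lt_trichotomy n a with hn | rfl | hn
  · simpa [hn.le, Nat.succ_le_of_lt hn] using hξ n
  · simpa using hz
  · have h1 : ¬ n ≤ a := by omega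
    have h2 : ¬ n + 1 ≤ a := by omega
    simp only [h1, h2, if_false, sub_self, map_zero, norm_zero]
    positivity

/-- Compactness: if any finite number of closed homogeneous conditions can be satisfied by a
quasi-constant sequence in `L`, then all of them can be satisfied simultaneously. -/
lemma exists_forall_mem [FiniteDimensional ℝ E] (h : IsTempered Φ M) (hε : ε ≤ 1 / 2)
    (L : Submodule ℝ E) (S : ℕ → Set (ℕ → E)) (hS : ∀ i, IsClosed (S i))
    (hsmul : ∀ i ξ (c : ℝ), 0 < c → ξ ∈ S i → c • ξ ∈ S i)
    (hfin : ∀ j, ∃ ξ, (∀ n, ξ n ∈ L) ∧ IsQuasiConstant Φ ε ξ ∧ ξ 0 ≠ 0 ∧ ∀ i < j, ξ ∈ S i) :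
    ∃ ξ, (∀ n, ξ n ∈ L) ∧ IsQuasiConstant Φ ε ξ ∧ ξ 0 ≠ 0 ∧ ∀ i, ξ ∈ S i := by
  have hM := h.one_le
  have : ProperSpace E := FiniteDimensional.proper ℝ E
  set X : Set (ℕ → E) := Set.pi univ fun n => Metric.closedBall 0 (M ^ n * (2 * M) ^ n) with hX
  have hXc : IsCompact X := isCompact_univ_pi fun n => isCompact_closedBall _ _
  -- The normalization puts `Q` inside the compact product `X` and keeps the limit from having `ξ 0
  -- = 0`.
  set Q : Set (ℕ → E) := {ξ | (∀ n, ξ n ∈ L) ∧ IsQuasiConstant Φ ε ξ ∧ ‖ξ 0‖ = 1} with hQ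
  have hQc : IsClosed Q := by
    have h1 : IsClosed {ξ : ℕ → E | ∀ n, ξ n ∈ L} := by
      simp only [ofPred_forall]
      exact isClosed_iInter fun n =>
        (Submodule.closed_of_finiteDimensional L).preimage (continuous_apply n)
    have h2 : IsClosed {ξ : ℕ → E | IsQuasiConstant Φ ε ξ} := by
      simp only [IsQuasiConstant, ofPred_forall]
      exact isClosed_iInter fun n => isClosed_le (by fun_prop) (by fun_prop)
    have h3 : IsClosed {ξ : ℕ → E | ‖ξ 0‖ = 1} := isClosed_eq (by fun_prop) (by fun_prop)
    exact h1.inter (h2.inter h3)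
  have hQX : Q ⊆ X := by
    rintro ξ ⟨-, h2, h3⟩ n -
    rw [mem_closedBall_zero_iff]
    have := h2.le_pow_mul h hε n
    rw [h3, mul_one] at this
    exact (h.norm_le n _).trans (by gcongr)
  let t : ℕ → Set (ℕ → E) := fun j => Q ∩ ⋂ i, ⋂ (_ : i < j), S i
  have htc : ∀ j, IsClosed (t j) := fun j =>
    hQc.inter (isClosed_iInter fun i => isClosed_iInter fun _ => hS i)
  obtain ⟨ξ, hξ⟩ := IsCompact.nonempty_iInter_of_sequence_nonempty_isCompact_isClosed t
    (by
      rintro j ξ ⟨h1, h2⟩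
      refine ⟨h1, ?_⟩
      simp only [mem_iInter] at h2 ⊢
      exact fun i hi => h2 i (by omega))
    (by
      intro j
      obtain ⟨ξ, h1, h2, h3, h4⟩ := hfin j
      have hpos : 0 < ‖ξ 0‖⁻¹ := inv_pos.2 (norm_pos_iff.2 h3)
      refine ⟨‖ξ 0‖⁻¹ • ξ, ⟨fun n => L.smul_mem _ (h1 n), h2.smul _, ?_⟩, ?_⟩
      · simp [norm_smul, h3]
      · simp only [mem_iInter]
        exact fun i hi => hsmul i ξ _ hpos (h4 i hi))
    (hXc.of_isClosed_subset (htc 0) (inter_subset_left.trans hQX)) htc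
  have hξ' : ∀ j, ξ ∈ t j := mem_iInter.1 hξ
  obtain ⟨h1, h2, h3⟩ := (hξ' 0).1
  refine ⟨ξ, h1, h2, ?_, fun i => ?_⟩
  · intro h0
    simp [h0] at h3
  · have := (hξ' (i + 1)).2
    simp only [mem_iInter] at this
    exact this i (by omega)

end IsQuasiConstant

/-- Uniform waiting time: an open homogeneous event that occurs along every orbit with initial
value in `L` occurs before a uniform time. -/
lemma exists_waiting_time [FiniteDimensional ℝ E] (Φ : ℕ → E →L[ℝ] E) (L : Submodule ℝ E) (s R : ℝ) (N : ℕ)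
    (hL : ∀ x ∈ L, x ≠ 0 → ∃ t ≥ N, s * (‖Φ t x‖ - R * ‖Φ N x‖) < 0) :
    ∃ T ≥ N, ∀ x ∈ L, ∃ t, N ≤ t ∧ t ≤ T ∧ s * (‖Φ t x‖ - R * ‖Φ N x‖) ≤ 0 := by
  have : ProperSpace E := FiniteDimensional.proper ℝ E
  have hc : IsCompact (Metric.sphere (0 : E) 1 ∩ L) :=
    (isCompact_sphere 0 1).inter_right (Submodule.closed_of_finiteDimensional L)
  let U : ℕ → Set E := fun T => ⋃ t, ⋃ (_ : N ≤ t ∧ t ≤ T), {x | s * (‖Φ t x‖ - R * ‖Φ N x‖) < 0}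
  obtain ⟨T, hT⟩ := hc.elim_directed_cover U
    (fun T => isOpen_iUnion fun t => isOpen_iUnion fun _ =>
      isOpen_lt (by fun_prop) continuous_const)
    (by
      rintro x ⟨hx1, hx2⟩
      have hx0 : x ≠ 0 := by
        rintro rfl
        simp at hx1
      obtain ⟨t, ht, hlt⟩ := hL x hx2 hx0
      exact mem_iUnion.2 ⟨t, mem_iUnion₂.2 ⟨t, ⟨ht, le_rfl⟩, hlt⟩⟩)
    (by
      refine directed_of_isDirected_le fun T T' hTT' x hx => ?_
      obtain ⟨t, ⟨h1, h2⟩, h3⟩ := mem_iUnion₂.1 hx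
      exact mem_iUnion₂.2 ⟨t, ⟨h1, h2.trans hTT'⟩, h3⟩)
  refine ⟨max N T, le_max_left _ _, fun x hx => ?_⟩
  by_cases hx0 : x = 0
  · exact ⟨N, le_rfl, le_max_left _ _, by simp [hx0]⟩
  have hpos : 0 < ‖x‖ := norm_pos_iff.2 hx0
  have hmem : ‖x‖⁻¹ • x ∈ Metric.sphere (0 : E) 1 ∩ L :=
    ⟨by simp [norm_smul, hx0], L.smul_mem _ hx⟩
  obtain ⟨t, ⟨h1, h2⟩, h3⟩ := mem_iUnion₂.1 (hT hmem)
  refine ⟨t, h1, h2.trans (le_max_right _ _), ?_⟩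
  simp only [mem_ofPred_eq, map_smul, norm_smul, norm_inv, norm_norm] at h3
  have h4 : ‖x‖⁻¹ * (s * (‖Φ t x‖ - R * ‖Φ N x‖)) < 0 := by
    calc _ = s * (‖x‖⁻¹ * ‖Φ t x‖ - R * (‖x‖⁻¹ * ‖Φ N x‖)) := by ring
      _ < 0 := h3
  by_contra hcon
  push Not at hcon
  have : 0 ≤ ‖x‖⁻¹ * (s * (‖Φ t x‖ - R * ‖Φ N x‖)) := by positivity
  linarith

/-- The vectors `x + y` and `x - y` differ by `2y`, so they cannot both be shorter than `y`. A kick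
of the right sign is therefore never cancelled by the orbit it is added to. -/
lemma exists_sign_norm_le_norm_add (x y : E) :
    ∃ σ : ℝ, |σ| = 1 ∧ ‖y‖ ≤ ‖x + σ • y‖ := by
  by_contra! hcon
  have h1 := hcon 1 (by simp)
  have h2 := hcon (-1) (by simp)
  have h3 := norm_sub_le (x + (1 : ℝ) • y) (x + (-1 : ℝ) • y)
  have h4 : x + (1 : ℝ) • y - (x + (-1 : ℝ) • y) = (2 : ℝ) • y := by module
  rw [h4, norm_smul] at h3
  norm_num at h1 h2 h3
  linarith

end Quasi

/-! ### Waiting windows, kicks, and finitely many prescribed events. -/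

section Schedule

variable {E : Type*} [NormedAddCommGroup E] [NormedSpace ℝ E]

/-- All windows and kick times are fixed before any sequence is built, so that the events are the
same conditions for every finite stage and compactness applies. -/
lemma exists_schedule {F : Type*} (W : ℕ → ℕ → ℕ → Prop) (V : ℕ → ℕ → ℕ → F → Prop)
    (hW : ∀ i N, ∃ T ≥ N, W i N T) (hV : ∀ i T, ∃ a b v, T ≤ a ∧ T ≤ b ∧ V i a b v) :
    ∃ (N T a b : ℕ → ℕ) (v : ℕ → F), ∀ i, N i ≤ T i ∧ T i ≤ a i ∧ T i ≤ b i ∧ a i < N (i + 1) ∧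
      b i < N (i + 1) ∧ W i (N i) (T i) ∧ V i (a i) (b i) (v i) := by
  choose T hT hWT using hW
  choose a b v hTa hTb hVab using hV
  let N : ℕ → ℕ := fun i => Nat.rec 0 (fun i N => max (a i (T i N)) (b i (T i N)) + 1) i
  refine ⟨N, fun i => T i (N i), fun i => a i (T i (N i)), fun i => b i (T i (N i)),
    fun i => v i (T i (N i)), fun i => ⟨hT _ _, hTa _ _, hTb _ _, ?_, ?_, hWT _ _, hVab _ _⟩⟩
  · exact Nat.lt_succ_of_le (le_max_left _ _)
  · exact Nat.lt_succ_of_le (le_max_right _ _)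

/-- Sequences for which `s * (‖Φ t (ξ t)‖ - R * ‖ξ 0‖) ≤ 0` at some time `t` between `N` and `T`,
and whose growth from time `a` to time `b` is at least `κ`. -/
def quasiEvent (Φ : ℕ → E →L[ℝ] E) (s R κ : ℝ) (N T a b : ℕ) : Set (ℕ → E) :=
  {ξ | (∃ t, (N ≤ t ∧ t ≤ T) ∧ s * (‖Φ t (ξ t)‖ - R * ‖ξ 0‖) ≤ 0) ∧
    κ * ‖Φ a (ξ a)‖ ≤ ‖Φ b (ξ b)‖}

variable {Φ : ℕ → E →L[ℝ] E} {M ε s : ℝ}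

/-- The time `t` ranges over a finite window, so the union over `t` stays closed; this is what a
uniform waiting time is needed for. -/
lemma isClosed_quasiEvent (R κ : ℝ) (N T a b : ℕ) : IsClosed (quasiEvent Φ s R κ N T a b) := by
  have h1 : {ξ : ℕ → E | ∃ t, (N ≤ t ∧ t ≤ T) ∧ s * (‖Φ t (ξ t)‖ - R * ‖ξ 0‖) ≤ 0} =
      ⋃ t ∈ Set.Icc N T, {ξ : ℕ → E | s * (‖Φ t (ξ t)‖ - R * ‖ξ 0‖) ≤ 0} := by
    ext ξ
    simp
  have h2 : IsClosed {ξ : ℕ → E | ∃ t, (N ≤ t ∧ t ≤ T) ∧ s * (‖Φ t (ξ t)‖ - R * ‖ξ 0‖) ≤ 0} := by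
    rw [h1]
    exact (Set.finite_Icc N T).isClosed_biUnion fun t _ =>
      isClosed_le (by fun_prop) continuous_const
  have h3 : IsClosed {ξ : ℕ → E | κ * ‖Φ a (ξ a)‖ ≤ ‖Φ b (ξ b)‖} :=
    isClosed_le (by fun_prop) (by fun_prop)
  exact h2.inter h3

lemma smul_mem_quasiEvent {R κ : ℝ} {N T a b : ℕ} {ξ : ℕ → E} {c : ℝ} (hc : 0 < c)
    (hξ : ξ ∈ quasiEvent Φ s R κ N T a b) : c • ξ ∈ quasiEvent Φ s R κ N T a b := by
  obtain ⟨⟨t, ht, h1⟩, h2⟩ := hξ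
  refine ⟨⟨t, ht, ?_⟩, ?_⟩
  · simp only [Pi.smul_apply, map_smul, norm_smul, Real.norm_of_nonneg hc.le]
    calc _ = c * (s * (‖Φ t (ξ t)‖ - R * ‖ξ 0‖)) := by ring
      _ ≤ 0 := mul_nonpos_of_nonneg_of_nonpos hc.le h1
  · simp only [Pi.smul_apply, map_smul, norm_smul, Real.norm_of_nonneg hc.le]
    calc _ = c * (κ * ‖Φ a (ξ a)‖) := by ring
      _ ≤ c * ‖Φ b (ξ b)‖ := by gcongr

lemma quasiEvent_congr {R κ : ℝ} {N T a b m : ℕ} {ξ η : ℕ → E} (hT : T ≤ m) (ha : a ≤ m)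
    (hb : b ≤ m) (h : ∀ n ≤ m, η n = ξ n) (hξ : ξ ∈ quasiEvent Φ s R κ N T a b) :
    η ∈ quasiEvent Φ s R κ N T a b := by
  obtain ⟨⟨t, ht, h1⟩, h2⟩ := hξ
  refine ⟨⟨t, ht, ?_⟩, ?_⟩
  · rwa [h t (ht.2.trans hT), h 0 (Nat.zero_le _)]
  · rwa [h a ha, h b hb]

variable {L : Submodule ℝ E} {R κ ρ : ℕ → ℝ} {N T a b : ℕ → ℕ} {v : ℕ → E}

/-- Here growth comes after the kick: at time `a j` the current value `z` receives a multiple of `v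
j` of relative size `ε`, which is visible at the later time `b j`. Earlier events depend only on
earlier values and are unaffected. -/
lemma exists_isQuasiConstant_forward (hε : 0 < ε)
    (hN : ∀ i, N i ≤ T i ∧ T i ≤ a i ∧ T i ≤ b i ∧ a i < N (i + 1) ∧ b i < N (i + 1))
    (hW : ∀ i, ∀ x ∈ L, ∃ t, N i ≤ t ∧ t ≤ T i ∧ s * (‖Φ t x‖ - ρ i * ‖Φ (N i) x‖) ≤ 0)
    (hρ : ∀ i ξ, IsQuasiConstant Φ ε ξ → s * (ρ i * ‖Φ (N i) (ξ (N i))‖ - R i * ‖ξ 0‖) ≤ 0)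
    (hv : ∀ i, v i ∈ L ∧ ‖Φ (a i) (v i)‖ = 1 ∧ 0 ≤ κ i ∧ κ i ≤ ‖Φ (b i) (v i)‖)
    (hab : ∀ i, a i < b i) (j : ℕ) :
    ∃ ξ, (∀ n, ξ n ∈ L) ∧ IsQuasiConstant Φ ε ξ ∧ ξ 0 ≠ 0 ∧
      (∀ n ≥ N j, ξ n = ξ (N j)) ∧
      ∀ i < j, ξ ∈ quasiEvent Φ s (R i) (ε / 4 * κ i) (N i) (T i) (a i) (b i) := by
  have hNmono : Monotone N := monotone_nat_of_le_succ fun i => by have := hN i; omega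
  induction j with
  | zero =>
    refine ⟨fun _ => v 0, fun _ => (hv 0).1, fun n => ?_, ?_, fun _ _ => rfl, by simp⟩
    · simp only [sub_self, map_zero, norm_zero]
      positivity
    · intro h0
      have := (hv 0).2.1
      simp only at h0
      rw [h0, map_zero, norm_zero] at this
      exact zero_ne_one this
  | succ j ih =>
    obtain ⟨ξ, hL, hq, h0, hconst, hev⟩ := ih
    obtain ⟨hNT, hTa, hTb, haN, hbN⟩ := hN j
    obtain ⟨hvL, hva, hκ, hvb⟩ := hv j
    set z := ξ (N j) with hz
    obtain ⟨σ, hσ, hσ'⟩ := exists_sign_norm_le_norm_add (Φ (b j) z)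
      (Φ (b j) ((ε * ‖Φ (a j) z‖) • v j))
    set w := z + σ • (ε * ‖Φ (a j) z‖) • v j with hw
    have hξa : ξ (a j) = z := hconst _ (by omega)
    have hηq : IsQuasiConstant Φ ε (fun n => if n ≤ a j then ξ n else w) := by
      refine hq.ite hε.le _ ?_
      rw [hξa, hw, add_sub_cancel_left, map_smul, map_smul, norm_smul, norm_smul, hva,
        Real.norm_eq_abs, hσ, Real.norm_of_nonneg (by positivity)]
      simp
    refine ⟨_, fun n => ?_, hηq, by simpa using h0, fun n hn => ?_, fun i hi => ?_⟩
    · by_cases hn : n ≤ a j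
      · simpa [hn] using hL n
      · simp only [hn, if_false]
        exact L.add_mem (hL _) (L.smul_mem _ (L.smul_mem _ hvL))
    · have h1 : ¬ n ≤ a j := by omega
      have h2 : ¬ N (j + 1) ≤ a j := by omega
      simp [h1, h2]
    · rcases Nat.lt_succ_iff_lt_or_eq.1 hi with hi | rfl
      · obtain ⟨h1, h2, h3, h4, h5⟩ := hN i
        have h6 : N (i + 1) ≤ N j := hNmono hi
        refine quasiEvent_congr (m := a j) (by omega) (by omega) (by omega) (fun n hn => ?_)
          (hev i hi)
        simp [hn]
      · obtain ⟨t, ht1, ht2, ht3⟩ := hW i z (hL _)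
        refine ⟨⟨t, ⟨ht1, ht2⟩, ?_⟩, ?_⟩
        · have hta : t ≤ a i := by omega
          have := hρ i ξ hq
          simp only [hta, if_true, Nat.zero_le]
          rw [hconst t ht1]
          rw [← hz] at this
          linarith
        · have h1 : ¬ b i ≤ a i := by have := hab i; omega
          simp only [le_refl, h1, if_true, if_false]
          rw [hξa, hw, map_add, map_smul]
          refine le_trans ?_ hσ'
          rw [map_smul, norm_smul, Real.norm_of_nonneg (by positivity)]
          have : 0 ≤ ε * ‖Φ (a i) z‖ := by positivity
          nlinarith [mul_le_mul_of_nonneg_left hvb this, mul_nonneg this hκ]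

/-- Here `v j` is large before it is small, so it has to be present at `b j` and be removed after `a
j`. The construction runs from the end: to finish at `u`, first aim at `u + e` with `e` along `v j`,
then drop `e`. Hence the terminal value is arbitrary in the induction. -/
lemma exists_isQuasiConstant_backward (hε : 0 < ε) (hε' : ε ≤ 1 / 2)
    (h : IsTempered Φ M)
    (hN : ∀ i, N i ≤ T i ∧ T i ≤ a i ∧ T i ≤ b i ∧ a i < N (i + 1) ∧ b i < N (i + 1))
    (hW : ∀ i, ∀ x ∈ L, ∃ t, N i ≤ t ∧ t ≤ T i ∧ s * (‖Φ t x‖ - ρ i * ‖Φ (N i) x‖) ≤ 0)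
    (hρ : ∀ i ξ, IsQuasiConstant Φ ε ξ → s * (ρ i * ‖Φ (N i) (ξ (N i))‖ - R i * ‖ξ 0‖) ≤ 0)
    (hv : ∀ i, v i ∈ L ∧ ‖Φ (a i) (v i)‖ = 1 ∧ 0 ≤ κ i ∧ κ i ≤ ‖Φ (b i) (v i)‖)
    (hab : ∀ i, b i < a i) (j : ℕ) (u : E) (huL : u ∈ L) (hu : u ≠ 0) :
    ∃ ξ, (∀ n, ξ n ∈ L) ∧ IsQuasiConstant Φ ε ξ ∧ ξ 0 ≠ 0 ∧
      (∀ n ≥ N j, ξ n = u) ∧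
      ∀ i < j, ξ ∈ quasiEvent Φ s (R i) (ε / 4 * κ i) (N i) (T i) (a i) (b i) := by
  have hNmono : Monotone N := monotone_nat_of_le_succ fun i => by have := hN i; omega
  induction j generalizing u with
  | zero =>
    refine ⟨fun _ => u, fun _ => huL, fun n => ?_, hu, fun _ _ => rfl, by simp⟩
    simp only [sub_self, map_zero, norm_zero]
    positivity
  | succ j ih =>
    obtain ⟨hNT, hTa, hTb, haN, hbN⟩ := hN j
    obtain ⟨hvL, hva, hκ, hvb⟩ := hv j
    obtain ⟨σ, hσ, hσ'⟩ := exists_sign_norm_le_norm_add (Φ (b j) u)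
      -- The kick is measured against `u`, but its removal is compared with `u + e`; as `‖Φ (a j) (u
      -- + e)‖` is at least half of `‖Φ (a j) u‖`, the size `ε / 2` is admissible.
      (Φ (b j) ((ε / 2 * ‖Φ (a j) u‖) • v j))
    set e := σ • (ε / 2 * ‖Φ (a j) u‖) • v j with he
    have hen : ‖Φ (a j) e‖ = ε / 2 * ‖Φ (a j) u‖ := by
      rw [he, map_smul, map_smul, norm_smul, norm_smul, hva,
        Real.norm_eq_abs, hσ, Real.norm_of_nonneg (by positivity)]
      simp
    have hupos := h.norm_pos (a j) hu
    have hz1 : ‖Φ (a j) (u + e)‖ ≤ 2 * ‖Φ (a j) u‖ := by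
      rw [map_add]
      refine (norm_add_le _ _).trans ?_
      rw [hen]
      nlinarith
    have hz2 : (1 - ε / 2) * ‖Φ (a j) u‖ ≤ ‖Φ (a j) (u + e)‖ := by
      have := norm_sub_le (Φ (a j) (u + e)) (Φ (a j) e)
      rw [← map_sub, add_sub_cancel_right, hen] at this
      linarith
    have hz0 : u + e ≠ 0 := by
      intro h0
      rw [h0, map_zero, norm_zero] at hz2
      nlinarith
    obtain ⟨ξ, hL, hq, h0, hconst, hev⟩ :=
      ih (u + e) (L.add_mem huL (L.smul_mem _ (L.smul_mem _ hvL))) hz0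
    have hξa : ξ (a j) = u + e := hconst _ (by omega)
    have hηq : IsQuasiConstant Φ ε (fun n => if n ≤ a j then ξ n else u) := by
      refine hq.ite hε.le _ ?_
      rw [hξa, sub_add_cancel_left, map_neg, norm_neg, hen]
      have : 1 / 2 * ‖Φ (a j) u‖ ≤ ‖Φ (a j) (u + e)‖ := by nlinarith
      nlinarith
    refine ⟨_, fun n => ?_, hηq, by simpa using h0, fun n hn => ?_, fun i hi => ?_⟩
    · by_cases hn : n ≤ a j
      · simpa [hn] using hL n
      · simpa only [hn, if_false] using huL
    · have h1 : ¬ n ≤ a j := by omega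
      simp [h1]
    · rcases Nat.lt_succ_iff_lt_or_eq.1 hi with hi | rfl
      · obtain ⟨h1, h2, h3, h4, h5⟩ := hN i
        have h6 : N (i + 1) ≤ N j := hNmono hi
        refine quasiEvent_congr (m := a j) (by omega) (by omega) (by omega) (fun n hn => ?_)
          (hev i hi)
        simp [hn]
      · obtain ⟨t, ht1, ht2, ht3⟩ := hW i (ξ (N i)) (hL _)
        refine ⟨⟨t, ⟨ht1, ht2⟩, ?_⟩, ?_⟩
        · have hta : t ≤ a i := by omega
          have := hρ i ξ hq
          simp only [hta, if_true, Nat.zero_le]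
          rw [hconst t ht1, ← hconst (N i) le_rfl]
          linarith
        · have h1 : b i ≤ a i := (hab i).le
          simp only [le_refl, h1, if_true]
          rw [hξa, hconst (b i) (by omega), he, map_add _ u, map_smul _ σ, map_add _ u,
            map_smul _ σ]
          refine le_trans ?_ hσ'
          rw [map_smul (Φ (b i)), norm_smul, Real.norm_of_nonneg (by positivity)]
          rw [map_add, he, map_smul _ σ] at hz1
          have : 0 ≤ ε / 2 * ‖Φ (a i) u‖ := by positivity
          calc _ ≤ ε / 4 * κ i * (2 * ‖Φ (a i) u‖) := by gcongr
            _ = ε / 2 * ‖Φ (a i) u‖ * κ i := by ring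
            _ ≤ _ := by gcongr

lemma IsTempered.exists_late_violation (h : IsTempered Φ M) (r : ℕ → ℕ → Prop)
    (hmax : ∀ a b N, r a b → r (max a N) (max b N) ∨ max a N = max b N)
    (hviol : ∀ K > 0, ∀ δ > 0, ∃ v ∈ L, ∃ a b : ℕ, r a b ∧
      K * Real.exp (-δ * |(a : ℝ) - b|) * ‖Φ a v‖ < ‖Φ b v‖)
    (N : ℕ) (K : ℝ) (hK : 0 < K) (δ : ℝ) (hδ : 0 < δ) :
    ∃ v ∈ L, ∃ a b : ℕ, N ≤ a ∧ N ≤ b ∧ r a b ∧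
      K * Real.exp (-δ * |(a : ℝ) - b|) * ‖Φ a v‖ < ‖Φ b v‖ := by
  have hM := h.one_le
  -- With a constant at least 1 the two clipped times cannot coincide, since a vector would then be
  -- longer than itself.
  have hK' : 0 < max K 1 := by positivity
  obtain ⟨v, hv, a, b, hab, hlt⟩ :=
    hviol (max K 1 * (M ^ N * M ^ N * Real.exp (δ * N))) (by positivity) δ hδ
  have h1 := h.late_violation hK' hδ N hlt
  refine ⟨v, hv, max a N, max b N, le_max_right _ _, le_max_right _ _, ?_, ?_⟩
  · rcases hmax a b N hab with h2 | h2
    · exact h2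
    · exfalso
      rw [h2] at h1
      simp only [sub_self, abs_zero, mul_zero, Real.exp_zero, mul_one] at h1
      nlinarith [norm_nonneg (Φ (max b N) v), le_max_right K 1]
  · refine lt_of_le_of_lt ?_ h1
    gcongr
    exact le_max_left _ _

end Schedule

/-! ### Infinitely many events along one quasi-constant sequence. -/

section Events

variable {E : Type*} [NormedAddCommGroup E] [NormedSpace ℝ E] [FiniteDimensional ℝ E]
  {Φ : ℕ → E →L[ℝ] E} {M ε s : ℝ} {L : Submodule ℝ E}

/-- The sign `s` treats both cases at once: waiting makes the orbit small for `s = 1` and large for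
`s = -1`. -/
lemma exists_isQuasiConstant_events (hε : 0 < ε) (hε' : ε ≤ 1 / 2) (h : IsTempered Φ M)
    (hs : s = 1 ∨ s = -1) (R : ℕ → ℝ) (hR : ∀ i, 0 < R i)
    (hwait : ∀ x ∈ L, x ≠ 0 → ∀ N, ∀ ρ > 0, ∃ t ≥ N, s * (‖Φ t x‖ - ρ * ‖Φ N x‖) < 0)
    (r : ℕ → ℕ → Prop) (hr : (∀ a b, r a b → a < b) ∨ ∀ a b, r a b → b < a)
    (hviol : ∀ N : ℕ, ∀ K > 0, ∀ δ > 0, ∃ v ∈ L, ∃ a b : ℕ, N ≤ a ∧ N ≤ b ∧ r a b ∧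
      K * Real.exp (-δ * |(a : ℝ) - b|) * ‖Φ a v‖ < ‖Φ b v‖) :
    ∃ ξ, IsQuasiConstant Φ ε ξ ∧ ξ 0 ≠ 0 ∧
      (∀ i, ∃ t ≥ i, s * (‖Φ t (ξ t)‖ - R i * ‖ξ 0‖) ≤ 0) ∧
      ∀ i : ℕ, ∃ a b, i ≤ a ∧ i ≤ b ∧ r a b ∧
        ε / 4 * (((i : ℝ) + 1) * Real.exp (-(1 / ((i : ℝ) + 1)) * |(a : ℝ) - b|)) * ‖Φ a (ξ a)‖
          ≤ ‖Φ b (ξ b)‖ := by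
  have hM := h.one_le
  -- The waiting target is relative to the state at `N`, the event to `‖ξ 0‖`. The factor `(2 * M) ^
  -- N` covers whatever kicks occurred before `N`.
  let ρ : ℕ → ℕ → ℝ := fun i N => if s = 1 then R i * ((2 * M) ^ N)⁻¹ else R i * (2 * M) ^ N
  have hρpos : ∀ i N, 0 < ρ i N := by
    intro i N
    have := hR i
    simp only [ρ]
    split_ifs <;> positivity
  have hρ : ∀ i N ξ, IsQuasiConstant Φ ε ξ →
      s * (ρ i N * ‖Φ N (ξ N)‖ - R i * ‖ξ 0‖) ≤ 0 := by
    intro i N ξ hξ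
    have h1 := hξ.le_pow_mul h hε' N
    have h2 := hξ.norm_le_pow_mul h hε' N
    have hRi := (hR i).le
    rcases hs with rfl | rfl
    · have h3 : ((2 * M) ^ N)⁻¹ * ‖Φ N (ξ N)‖ ≤ ‖ξ 0‖ := by
        rw [inv_mul_le_iff₀ (by positivity)]
        exact h1
      have := mul_le_mul_of_nonneg_left h3 hRi
      simp only [ρ, if_true]
      linarith
    · have := mul_le_mul_of_nonneg_left h2 hRi
      have hne : ¬ (-1 : ℝ) = 1 := by norm_num
      simp only [ρ, hne, if_false]
      linarith
  obtain ⟨N, T, a, b, v, hsched⟩ := exists_schedule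
    (fun i N T => ∀ x ∈ L, ∃ t, N ≤ t ∧ t ≤ T ∧ s * (‖Φ t x‖ - ρ i N * ‖Φ N x‖) ≤ 0)
    (fun i a b (v : E) => r a b ∧ v ∈ L ∧ ‖Φ a v‖ = 1 ∧
      ((i : ℝ) + 1) * Real.exp (-(1 / ((i : ℝ) + 1)) * |(a : ℝ) - b|) ≤ ‖Φ b v‖)
    (fun i N => exists_waiting_time Φ L s (ρ i N) N
      fun x hx hx0 => hwait x hx hx0 N _ (hρpos i N))
    (by
      intro i T
      obtain ⟨v, hv, a, b, ha, hb, hab, hlt⟩ :=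
        hviol T ((i : ℝ) + 1) (by positivity) (1 / ((i : ℝ) + 1)) (by positivity)
      have hv0 : v ≠ 0 := by
        rintro rfl
        simp at hlt
      have hpos := h.norm_pos a hv0
      refine ⟨a, b, ‖Φ a v‖⁻¹ • v, ha, hb, hab, L.smul_mem _ hv, ?_, ?_⟩
      · rw [map_smul, norm_smul, norm_inv, norm_norm, inv_mul_cancel₀ hpos.ne']
      · rw [map_smul, norm_smul, norm_inv, norm_norm, ← div_eq_inv_mul, le_div_iff₀ hpos]
        exact hlt.le)
  have hN : ∀ i, N i ≤ T i ∧ T i ≤ a i ∧ T i ≤ b i ∧ a i < N (i + 1) ∧ b i < N (i + 1) :=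
    fun i => ⟨(hsched i).1, (hsched i).2.1, (hsched i).2.2.1, (hsched i).2.2.2.1,
      (hsched i).2.2.2.2.1⟩
  have hW := fun i => (hsched i).2.2.2.2.2.1
  have hV := fun i => (hsched i).2.2.2.2.2.2
  let κ : ℕ → ℝ := fun i =>
    ((i : ℝ) + 1) * Real.exp (-(1 / ((i : ℝ) + 1)) * |(a i : ℝ) - b i|)
  have hv : ∀ i, v i ∈ L ∧ ‖Φ (a i) (v i)‖ = 1 ∧ 0 ≤ κ i ∧ κ i ≤ ‖Φ (b i) (v i)‖ :=
    fun i => ⟨(hV i).2.1, (hV i).2.2.1, by positivity, (hV i).2.2.2⟩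
  have hNmono : StrictMono N := strictMono_nat_of_lt_succ fun i => by have := hN i; omega
  have hNge : ∀ i, i ≤ N i := fun i => hNmono.le_apply
  have hfin : ∀ j, ∃ ξ, (∀ n, ξ n ∈ L) ∧ IsQuasiConstant Φ ε ξ ∧ ξ 0 ≠ 0 ∧
      ∀ i < j, ξ ∈ quasiEvent Φ s (R i) (ε / 4 * κ i) (N i) (T i) (a i) (b i) := by
    intro j
    rcases hr with hr | hr
    · obtain ⟨ξ, h1, h2, h3, -, h4⟩ := exists_isQuasiConstant_forward (R := R) hε hN hW
        (fun i => hρ i (N i)) hv (fun i => hr _ _ (hV i).1) j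
      exact ⟨ξ, h1, h2, h3, h4⟩
    · have hv0 : v 0 ≠ 0 := by
        intro h0
        have := (hv 0).2.1
        rw [h0, map_zero, norm_zero] at this
        exact zero_ne_one this
      obtain ⟨ξ, h1, h2, h3, -, h4⟩ := exists_isQuasiConstant_backward (R := R) hε hε' h hN hW
        (fun i => hρ i (N i)) hv (fun i => hr _ _ (hV i).1) j (v 0) (hv 0).1 hv0
      exact ⟨ξ, h1, h2, h3, h4⟩
  obtain ⟨ξ, -, hq, h0, hev⟩ := IsQuasiConstant.exists_forall_mem h hε' L _
    (fun i => isClosed_quasiEvent _ _ _ _ _ _) (fun i ξ c hc hξ => smul_mem_quasiEvent hc hξ) hfin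
  refine ⟨ξ, hq, h0, fun i => ?_, fun i => ?_⟩
  · obtain ⟨⟨t, ht, h1⟩, -⟩ := hev i
    exact ⟨t, (hNge i).trans ht.1, h1⟩
  · have h1 := hNge i
    have h2 := hN i
    exact ⟨a i, b i, by omega, by omega, (hV i).1, (hev i).2⟩

/-- If all orbits in `L` decay, but not uniformly, then there is a quasi-constant sequence whose
orbit neither decays nor grows. -/
lemma IsTempered.exists_not_decaying (hε : 0 < ε) (hε' : ε ≤ 1 / 2) (h : IsTempered Φ M)
    (hlim : ∀ x ∈ L, Filter.Tendsto (fun n => ‖Φ n x‖) Filter.atTop (nhds 0))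
    (hviol : ∀ K > 0, ∀ δ > 0, ∃ v ∈ L, ∃ a b : ℕ, a < b ∧
      K * Real.exp (-δ * |(a : ℝ) - b|) * ‖Φ a v‖ < ‖Φ b v‖) :
    ∃ ξ, IsQuasiConstant Φ ε ξ ∧ ξ 0 ≠ 0 ∧
      (∀ i, ∃ t ≥ i, ‖Φ t (ξ t)‖ ≤ ‖ξ 0‖) ∧
      ∀ i : ℕ, ∃ a b, i ≤ a ∧ a < b ∧
        ε / 4 * (((i : ℝ) + 1) * Real.exp (-(1 / ((i : ℝ) + 1)) * |(a : ℝ) - b|)) * ‖Φ a (ξ a)‖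
          ≤ ‖Φ b (ξ b)‖ := by
  obtain ⟨ξ, h1, h2, h3, h4⟩ := exists_isQuasiConstant_events (s := 1) hε hε' h (Or.inl rfl)
    (fun _ => 1) (fun _ => one_pos) (L := L) (by
      intro x hx hx0 N ρ hρ
      have hpos : 0 < ρ * ‖Φ N x‖ := mul_pos hρ (h.norm_pos N hx0)
      obtain ⟨t, ht1, ht2⟩ :=
        (((hlim x hx).eventually (gt_mem_nhds hpos)).and (Filter.eventually_ge_atTop N)).exists
      exact ⟨t, ht2, by linarith⟩)
    (· < ·) (Or.inl fun a b hab => hab)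
    (h.exists_late_violation _ (fun a b N hab => by omega) hviol)
  refine ⟨ξ, h1, h2, fun i => ?_, fun i => ?_⟩
  · obtain ⟨t, ht, h5⟩ := h3 i
    exact ⟨t, ht, by linarith⟩
  · obtain ⟨a, b, h5, -, h6⟩ := h4 i
    exact ⟨a, b, h5, h6⟩

/-- If all nonzero orbits in `L` tend to infinity, but do not grow uniformly, then there is a
quasi-constant sequence whose orbit neither decays nor grows. -/
lemma IsTempered.exists_not_growing (hε : 0 < ε) (hε' : ε ≤ 1 / 2) (h : IsTempered Φ M)
    (hlim : ∀ x ∈ L, x ≠ 0 → Filter.Tendsto (fun n => ‖Φ n x‖) Filter.atTop Filter.atTop)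
    (hviol : ∀ K > 0, ∀ δ > 0, ∃ v ∈ L, ∃ a b : ℕ, b < a ∧
      K * Real.exp (-δ * |(a : ℝ) - b|) * ‖Φ a v‖ < ‖Φ b v‖) :
    ∃ ξ, IsQuasiConstant Φ ε ξ ∧ ξ 0 ≠ 0 ∧
      (∀ i : ℕ, ∃ t, ((i : ℝ) + 1) * ‖ξ 0‖ ≤ ‖Φ t (ξ t)‖) ∧
      ∀ i : ℕ, ∃ a b, i ≤ b ∧ b < a ∧
        ε / 4 * (((i : ℝ) + 1) * Real.exp (-(1 / ((i : ℝ) + 1)) * |(a : ℝ) - b|)) * ‖Φ a (ξ a)‖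
          ≤ ‖Φ b (ξ b)‖ := by
  obtain ⟨ξ, h1, h2, h3, h4⟩ := exists_isQuasiConstant_events (s := -1) hε hε' h (Or.inr rfl)
    (fun i => (i : ℝ) + 1) (fun _ => by positivity) (L := L) (by
      intro x hx hx0 N ρ hρ
      obtain ⟨t, ht1, ht2⟩ := (((hlim x hx hx0).eventually_gt_atTop (ρ * ‖Φ N x‖)).and
        (Filter.eventually_ge_atTop N)).exists
      exact ⟨t, ht2, by linarith⟩)
    (fun a b => b < a) (Or.inr fun a b hab => hab)
    (h.exists_late_violation _ (fun a b N hab => by omega) hviol)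
  refine ⟨ξ, h1, h2, fun i => ?_, fun i => ?_⟩
  · obtain ⟨t, ht, h5⟩ := h3 i
    exact ⟨t, by linarith⟩
  · obtain ⟨a, b, -, h5, h6⟩ := h4 i
    exact ⟨a, b, h5, h6⟩

end Events

/-! ### Lyapunov functions along orbits and the splitting they produce. -/

section Lyapunov

/-- As `p ≥ V / C`, each step multiplies `V` by at most `1 - c / C`, and `(1 + q) * (1 - q) ≤ 1`.
Nonnegativity of the next value gives `c * p ≤ V`, which returns the decay to `p`. -/
lemma pow_mul_le_of_lyapunov_nonneg {p V : ℕ → ℝ} {c C : ℝ} (hc : 0 < c) (hcC : c ≤ C)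
    (hV : ∀ n, |V n| ≤ C * p n) (hdec : ∀ n, V (n + 1) ≤ V n - c * p n) (hpos : ∀ n, 0 ≤ V n)
    (m k : ℕ) : (1 + c / C) ^ k * p (m + k) ≤ 2 * C / c * p m := by
  have hC : 0 < C := hc.trans_le hcC
  have hp : ∀ n, 0 ≤ p n := fun n => nonneg_of_mul_nonneg_right ((abs_nonneg _).trans (hV n)) hC
  have h1 : (1 + c / C) ^ k * V (m + k) ≤ V m := by
    induction k with
    | zero => simp
    | succ k ih =>
      have h2 : (1 + c / C) * V (m + k + 1) ≤ V (m + k) := by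
        have h3 : c / C * V (m + k) ≤ c * p (m + k) := by
          rw [div_mul_eq_mul_div, div_le_iff₀ hC]
          nlinarith [(abs_le.1 (hV (m + k))).2]
        have h4 : V (m + k + 1) ≤ (1 - c / C) * V (m + k) := by linarith [hdec (m + k)]
        have h5 : 0 ≤ c / C := by positivity
        calc _ ≤ (1 + c / C) * ((1 - c / C) * V (m + k)) := by gcongr
          _ = V (m + k) - (c / C) ^ 2 * V (m + k) := by ring
          _ ≤ V (m + k) := by nlinarith [mul_nonneg (sq_nonneg (c / C)) (hpos (m + k))]
      calc (1 + c / C) ^ (k + 1) * V (m + (k + 1))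
          = (1 + c / C) ^ k * ((1 + c / C) * V (m + k + 1)) := by rw [pow_succ, add_assoc]; ring
        _ ≤ (1 + c / C) ^ k * V (m + k) := by gcongr
        _ ≤ V m := ih
  have h2 : c * p (m + k) ≤ V (m + k) := by linarith [hdec (m + k), hpos (m + k + 1)]
  rw [div_mul_eq_mul_div, le_div_iff₀ hc]
  calc (1 + c / C) ^ k * p (m + k) * c = (1 + c / C) ^ k * (c * p (m + k)) := by ring
    _ ≤ (1 + c / C) ^ k * V (m + k) := by gcongr
    _ ≤ V m := h1
    _ ≤ C * p m := (abs_le.1 (hV m)).2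
    _ ≤ 2 * C * p m := by nlinarith [mul_nonneg hC.le (hp m)]

/-- Once `V` is nonpositive, `-V` is at least `c * p m` one step after `m` and then grows by `1 + c
/ C` per step. The initial step loses one such factor, at most 2, whence the 2 in the constant. -/
lemma pow_mul_le_of_lyapunov_nonpos {p V : ℕ → ℝ} {c C : ℝ} (hc : 0 < c) (hcC : c ≤ C)
    (hV : ∀ n, |V n| ≤ C * p n) (hdec : ∀ n, V (n + 1) ≤ V n - c * p n) (hneg : V 0 ≤ 0)
    (m k : ℕ) : (1 + c / C) ^ k * p m ≤ 2 * C / c * p (m + k) := by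
  have hC : 0 < C := hc.trans_le hcC
  have hp : ∀ n, 0 ≤ p n := fun n => nonneg_of_mul_nonneg_right ((abs_nonneg _).trans (hV n)) hC
  have hanti : Antitone V := antitone_nat_of_succ_le fun n => by
    nlinarith [hdec n, mul_nonneg hc.le (hp n)]
  have h1 : c / C ≤ 1 := by rw [div_le_one hC]; exact hcC
  have hcC' : 0 ≤ c / C := by positivity
  rcases k with _ | k
  · simp only [pow_zero, one_mul, add_zero]
    have : 1 ≤ 2 * C / c := by rw [le_div_iff₀ hc]; linarith
    nlinarith [hp m]
  · have h2 : (1 + c / C) ^ k * (c * p m) ≤ - V (m + 1 + k) := by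
      induction k with
      | zero =>
        have := hdec m
        have := hanti (Nat.zero_le m)
        simp only [pow_zero, add_zero]
        linarith
      | succ k ih =>
        have h3 : -V (m + 1 + k) * (c / C) ≤ c * p (m + 1 + k) := by
          rw [mul_div_assoc', div_le_iff₀ hC]
          nlinarith [(abs_le.1 (hV (m + 1 + k))).1]
        calc (1 + c / C) ^ (k + 1) * (c * p m)
            = (1 + c / C) * ((1 + c / C) ^ k * (c * p m)) := by ring
          _ ≤ (1 + c / C) * (- V (m + 1 + k)) := by gcongr
          _ ≤ - V (m + 1 + k) + c * p (m + 1 + k) := by linarith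
          _ ≤ - V (m + 1 + (k + 1)) := by
            rw [← add_assoc (m + 1) k 1]
            linarith [hdec (m + 1 + k)]
    rw [div_mul_eq_mul_div, le_div_iff₀ hc]
    have h4 : - V (m + 1 + k) ≤ C * p (m + 1 + k) := by linarith [(abs_le.1 (hV (m + 1 + k))).1]
    have e : m + (k + 1) = m + 1 + k := by ring
    rw [e]
    calc (1 + c / C) ^ (k + 1) * p m * c = (1 + c / C) * ((1 + c / C) ^ k * (c * p m)) := by ring
      _ ≤ 2 * (C * p (m + 1 + k)) := by
        apply mul_le_mul _ (h2.trans h4) _ two_pos.le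
        · linarith
        · have := hp m
          positivity
      _ = _ := by ring

variable {E : Type*} [NormedAddCommGroup E] [NormedSpace ℝ E] [FiniteDimensional ℝ E]

/-- The subspace of initial values of bounded orbits. -/
def boundedOrbits (Ψ : ℕ → E →L[ℝ] E) : Submodule ℝ E where
  carrier := {x | ∃ r, ∀ n, ‖Ψ n x‖ ≤ r}
  zero_mem' := ⟨0, by simp⟩
  add_mem' := by
    rintro x y ⟨r, hr⟩ ⟨r', hr'⟩
    refine ⟨r + r', fun n => ?_⟩
    rw [map_add]
    exact (norm_add_le _ _).trans (add_le_add (hr n) (hr' n))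
  smul_mem' := by
    rintro c x ⟨r, hr⟩
    refine ⟨‖c‖ * r, fun n => ?_⟩
    rw [map_smul, norm_smul]
    gcongr
    exact hr n

/-- A Lyapunov function that is nonnegative on large enough subspaces and negative on a
complementary subspace yields a splitting into uniformly decaying and uniformly growing orbits. -/
theorem isCompl_boundedOrbits_of_lyapunov {Ψ : ℕ → E →L[ℝ] E}
    (hinj : ∀ n, Function.Injective (Ψ n)) {G : ℕ → E → ℝ} {c C : ℝ} (hc : 0 < c) (hcC : c ≤ C)
    (hGc : ∀ n, Continuous (G n)) (hG : ∀ n x, |G n x| ≤ C * ‖x‖)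
    (hdec : ∀ n x, G (n + 1) (Ψ (n + 1) x) ≤ G n (Ψ n x) - c * ‖Ψ n x‖)
    {L : Submodule ℝ E} {F : ℕ → Submodule ℝ E}
    (hF : ∀ n, ∀ x ∈ F n, 0 ≤ G n x)
    (hdim : ∀ n, Module.finrank ℝ (F n) + Module.finrank ℝ L = Module.finrank ℝ E)
    (hL : ∀ y ∈ L, y ≠ 0 → G 0 (Ψ 0 y) < 0)
    (hbdd : ∀ x, ∃ r, ∀ y ∈ L, 0 ≤ G 0 (Ψ 0 (x - y)) → ‖y‖ ≤ r) :
    IsCompl (boundedOrbits Ψ) L ∧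
      (∀ x ∈ boundedOrbits Ψ, ∀ m k : ℕ,
        (1 + c / C) ^ k * ‖Ψ (m + k) x‖ ≤ 2 * C / c * ‖Ψ m x‖) ∧
      (∀ x ∈ L, ∀ m k : ℕ, (1 + c / C) ^ k * ‖Ψ m x‖ ≤ 2 * C / c * ‖Ψ (m + k) x‖) := by
  have : ProperSpace E := FiniteDimensional.proper ℝ E
  have hC : 0 < C := hc.trans_le hcC
  have hanti : ∀ x, Antitone fun n => G n (Ψ n x) := fun x =>
    antitone_nat_of_succ_le fun n => by
      nlinarith [hdec n x, mul_nonneg hc.le (norm_nonneg (Ψ n x))]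
  have hunbdd : ∀ x n, G n (Ψ n x) < 0 → x ∉ boundedOrbits Ψ := by
    rintro x n hn ⟨r, hr⟩
    have hpos : 0 < ‖Ψ n x‖ := by
      rw [norm_pos_iff]
      intro h0
      have := hG n (Ψ n x)
      rw [h0, norm_zero, mul_zero] at this
      rw [h0] at hn
      exact hn.ne (abs_nonpos_iff.1 this)
    have hρ : 1 < 1 + c / C := by linarith [div_pos hc hC]
    obtain ⟨k, hk⟩ := pow_unbounded_of_one_lt (2 * C / c * r / ‖Ψ n x‖) hρ
    have h1 := pow_mul_le_of_lyapunov_nonpos (p := fun j => ‖Ψ (n + j) x‖)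
      (V := fun j => G (n + j) (Ψ (n + j) x)) hc hcC (fun j => hG _ _) (fun j => hdec _ _)
      hn.le 0 k
    simp only [add_zero, zero_add] at h1
    rw [div_lt_iff₀ hpos] at hk
    have h2 : 2 * C / c * ‖Ψ (n + k) x‖ ≤ 2 * C / c * r := by
      gcongr
      exact hr _
    linarith
  have hmem : ∀ x, x ∈ boundedOrbits Ψ ↔ ∀ n, 0 ≤ G n (Ψ n x) := by
    intro x
    constructor
    · intro hx n
      by_contra! hn
      exact hunbdd x n hn hx
    · intro hx
      refine ⟨2 * C / c * ‖Ψ 0 x‖, fun n => ?_⟩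
      have h1 := pow_mul_le_of_lyapunov_nonneg (p := fun j => ‖Ψ j x‖)
        (V := fun j => G j (Ψ j x)) hc hcC (fun j => hG _ _) (fun j => hdec _ _) hx 0 n
      simp only [zero_add] at h1
      refine le_trans ?_ h1
      have : 1 ≤ (1 + c / C) ^ n := one_le_pow₀ (by linarith [div_pos hc hC])
      nlinarith [norm_nonneg (Ψ n x)]
  refine ⟨⟨?_, ?_⟩, fun x hx m k => ?_, fun x hx m k => ?_⟩
  · rw [Submodule.disjoint_def]
    intro x hx hxL
    by_contra hx0
    exact hunbdd x 0 (hL x hxL hx0) hx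
  · rw [codisjoint_iff, Submodule.eq_top_iff']
    intro x
    obtain ⟨r, hr⟩ := hbdd x
    -- The sets of admissible `L`-components of `x` are nested and compact; a common point leaves a
    -- remainder with `G` nonnegative forever, hence a bounded orbit.
    let t : ℕ → Set E := fun n => {y | y ∈ L ∧ 0 ≤ G n (Ψ n (x - y))}
    have htc : ∀ n, IsClosed (t n) := fun n =>
      (Submodule.closed_of_finiteDimensional L).inter
        (isClosed_le continuous_const ((hGc n).comp (by fun_prop)))
    obtain ⟨y, hy⟩ := IsCompact.nonempty_iInter_of_sequence_nonempty_isCompact_isClosed t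
      (fun n y hy => ⟨hy.1, hy.2.trans (hanti _ (Nat.le_succ n))⟩)
      (by
        intro n
        -- `G n` is nonnegative on `F n` and negative on nonzero vectors of the image of `L`; the
        -- dimension count then makes them complementary, so `Ψ n x` can be split.
        have hdis : Disjoint (F n) (L.map (Ψ n : E →ₗ[ℝ] E)) := by
          rw [Submodule.disjoint_def]
          rintro z hz ⟨y, hy, rfl⟩
          by_contra hz0
          have hy0 : y ≠ 0 := by
            rintro rfl
            simp at hz0
          have h1 := hF n _ hz
          have h2 := hanti y (Nat.zero_le n)
          have h3 := hL y hy hy0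
          simp only [ContinuousLinearMap.coe_coe] at h1
          simp only at h2
          linarith
        have hfr : Module.finrank ℝ (L.map (Ψ n : E →ₗ[ℝ] E)) = Module.finrank ℝ L :=
          (Submodule.equivMapOfInjective (Ψ n : E →ₗ[ℝ] E) (hinj n) L).finrank_eq.symm
        have htop := Submodule.eq_top_of_disjoint _ _ (by rw [hfr, hdim n]) hdis
        obtain ⟨z, hz, w, ⟨y, hy, rfl⟩, hzw⟩ :=
          Submodule.mem_sup.1 (htop ▸ Submodule.mem_top : Ψ n x ∈ F n ⊔ L.map (Ψ n : E →ₗ[ℝ] E))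
        refine ⟨y, hy, ?_⟩
        have : Ψ n (x - y) = z := by
          rw [map_sub, ← hzw]
          simp
        rw [this]
        exact hF n z hz)
      ((isCompact_closedBall (0 : E) r).of_isClosed_subset (htc 0)
        (fun y hy => mem_closedBall_zero_iff.2 (hr y hy.1 hy.2))) htc
    have hy' : ∀ n, y ∈ t n := mem_iInter.1 hy
    exact Submodule.mem_sup.2 ⟨x - y, (hmem _).2 fun n => (hy' n).2, y, (hy' 0).1, by simp⟩
  · exact pow_mul_le_of_lyapunov_nonneg (p := fun j => ‖Ψ j x‖)
      (V := fun j => G j (Ψ j x)) hc hcC (fun j => hG _ _) (fun j => hdec _ _) ((hmem x).1 hx) m k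
  · refine pow_mul_le_of_lyapunov_nonpos (p := fun j => ‖Ψ j x‖)
      (V := fun j => G j (Ψ j x)) hc hcC (fun j => hG _ _) (fun j => hdec _ _) ?_ m k
    by_cases hx0 : x = 0
    · have := hG 0 0
      rw [norm_zero, mul_zero] at this
      simp [hx0, abs_nonpos_iff.1 this]
    · exact (hL x hx hx0).le

end Lyapunov

/-! ### Persistence of the splitting under small perturbations. -/

section Roughness

variable {E : Type*} [NormedAddCommGroup E] [NormedSpace ℝ E] {Φ : ℕ → E →L[ℝ] E} {M : ℝ}

/-- The orbits starting in two subspaces that halve resp. double their norm in `T` steps keep a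
positive angle. -/
lemma IsTempered.norm_add_norm_le (h : IsTempered Φ M) {L₁ L₂ : Submodule ℝ E} {T : ℕ}
    (h₁ : ∀ x ∈ L₁, ∀ n, 2 * ‖Φ (n + T) x‖ ≤ ‖Φ n x‖)
    (h₂ : ∀ x ∈ L₂, ∀ n, 2 * ‖Φ n x‖ ≤ ‖Φ (n + T) x‖) {x y : E} (hx : x ∈ L₁) (hy : y ∈ L₂)
    (n : ℕ) : ‖Φ n x‖ + ‖Φ n y‖ ≤ 4 * M ^ T * ‖Φ n (x + y)‖ := by
  have hM := h.one_le
  have hMT : 1 ≤ M ^ T := one_le_pow₀ hM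
  have e1 := h.up_add n T (x + y)
  have e2 : ‖Φ (n + T) y‖ - ‖Φ (n + T) x‖ ≤ ‖Φ (n + T) (x + y)‖ := by
    rw [map_add, add_comm (Φ (n + T) x)]
    simpa using norm_sub_norm_le (Φ (n + T) y) (-Φ (n + T) x)
  have e3 : ‖Φ n x‖ - ‖Φ n y‖ ≤ ‖Φ n (x + y)‖ := by
    rw [map_add]
    simpa using norm_sub_norm_le (Φ n x) (-Φ n y)
  have e4 := h₁ x hx n
  have e5 := h₂ y hy n
  -- If the two parts nearly cancelled at `n`, one would dominate the other at `n + T`.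
  -- Quantitatively: twice the estimate at `n + T` plus twice the one at `n`.
  nlinarith [norm_nonneg (Φ n (x + y)), mul_le_mul_of_nonneg_right hMT (norm_nonneg (Φ n (x + y)))]

variable [FiniteDimensional ℝ E]

/-- Roughness: the splitting persists for an orbit family `Ψ` whose one-step maps are close to
those of `Φ`. -/
theorem IsTempered.exists_roughness (h : IsTempered Φ M) {L₁ L₂ : Submodule ℝ E}
    (hL : IsCompl L₁ L₂) {T : ℕ} (hT : 1 ≤ T)
    (h₁ : ∀ x ∈ L₁, ∀ n, 2 * ‖Φ (n + T) x‖ ≤ ‖Φ n x‖)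
    (h₂ : ∀ x ∈ L₂, ∀ n, 2 * ‖Φ n x‖ ≤ ‖Φ (n + T) x‖) :
    ∃ η > 0, ∃ ρ > 1, ∃ K > 0, ∀ Ψ : ℕ → E →L[ℝ] E, Ψ 0 = ContinuousLinearMap.id ℝ E →
      (∀ n, Function.Injective (Ψ n)) →
      (∀ n x y, Ψ n x = Φ n y → ‖Ψ (n + 1) x - Φ (n + 1) y‖ ≤ η * ‖Ψ n x‖) →
      ∃ L : Submodule ℝ E, IsCompl L L₂ ∧
        (∀ x ∈ L, ∀ m k : ℕ, ρ ^ k * ‖Ψ (m + k) x‖ ≤ K * ‖Ψ m x‖) ∧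
        (∀ x ∈ L₂, ∀ m k : ℕ, ρ ^ k * ‖Ψ m x‖ ≤ K * ‖Ψ (m + k) x‖) := by
  have hM := h.one_le
  have hΦinj : ∀ n, Function.Injective (Φ n) := fun n => by
    rw [injective_iff_map_eq_zero]
    intro x hx
    by_contra hx0
    exact (h.norm_pos n hx0).ne' (by rw [hx, norm_zero])
  let P : E →L[ℝ] E := LinearMap.toContinuousLinearMap (L₁.projection L₂ hL)
  let Q : E →L[ℝ] E := LinearMap.toContinuousLinearMap (L₂.projection L₁ hL.symm)
  have hP : ∀ x, P x ∈ L₁ := fun x => Submodule.projection_apply_mem hL x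
  have hQ : ∀ x, Q x ∈ L₂ := fun x => Submodule.projection_apply_mem hL.symm x
  have hPQ : ∀ x, P x + Q x = x := fun x => Submodule.projection_add_projection_eq_self hL x
  have hP₂ : ∀ x ∈ L₂, P x = 0 := fun x hx => (Submodule.projection_apply_eq_zero_iff hL).2 hx
  have hQ₂ : ∀ x ∈ L₂, Q x = x := fun x hx => Submodule.projection_apply_of_mem_left hL.symm hx
  have hQ₁ : ∀ x ∈ L₁, Q x = 0 := fun x hx =>
    (Submodule.projection_apply_eq_zero_iff hL.symm).2 hx
  let Θ : ℕ → E →L[ℝ] E := fun n => LinearMap.toContinuousLinearMap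
    ((LinearEquiv.ofInjectiveEndo (Φ n : E →ₗ[ℝ] E) (hΦinj n)).symm : E →ₗ[ℝ] E)
  have hΦΘ : ∀ n x, Φ n (Θ n x) = x := fun n x =>
    (LinearEquiv.ofInjectiveEndo (Φ n : E →ₗ[ℝ] E) (hΦinj n)).apply_symm_apply x
  have hΘΦ : ∀ n x, Θ n (Φ n x) = x := fun n x =>
    (LinearEquiv.ofInjectiveEndo (Φ n : E →ₗ[ℝ] E) (hΦinj n)).symm_apply_apply x
  -- `Θ n` pulls the state back to time 0, so `G n` is a function of the state alone and can be
  -- evaluated along `Ψ`. Shifting the window by one step telescopes the sum.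
  let G : ℕ → E → ℝ := fun n x =>
    ∑ j ∈ Finset.range T, (‖Φ (n + j) (P (Θ n x))‖ - ‖Φ (n + j) (Q (Θ n x))‖)
  have hGΦ : ∀ n x, G n (Φ n x) =
      ∑ j ∈ Finset.range T, (‖Φ (n + j) (P x)‖ - ‖Φ (n + j) (Q x)‖) := fun n x => by
    simp only [G, hΘΦ]
  set C : ℝ := T * (M ^ T * (4 * M ^ T)) with hCdef
  have hMT : 1 ≤ M ^ T := one_le_pow₀ hM
  have hC1 : 1 ≤ C := by
    have : (1 : ℝ) ≤ T := by exact_mod_cast hT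
    exact one_le_mul_of_one_le_of_one_le this
      (one_le_mul_of_one_le_of_one_le hMT (by linarith))
  have hGlip : ∀ n x y, |G n x - G n y| ≤ C * ‖x - y‖ := by
    intro n x y
    have hterm : ∀ j ∈ Finset.range T,
        |(‖Φ (n + j) (P (Θ n x))‖ - ‖Φ (n + j) (Q (Θ n x))‖) -
          (‖Φ (n + j) (P (Θ n y))‖ - ‖Φ (n + j) (Q (Θ n y))‖)|
          ≤ M ^ T * (4 * M ^ T) * ‖x - y‖ := by
      intro j hj
      have hjT : M ^ j ≤ M ^ T := pow_le_pow_right₀ hM (Finset.mem_range.1 hj).le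
      have e1 := abs_norm_sub_norm_le (Φ (n + j) (P (Θ n x))) (Φ (n + j) (P (Θ n y)))
      have e2 := abs_norm_sub_norm_le (Φ (n + j) (Q (Θ n x))) (Φ (n + j) (Q (Θ n y)))
      simp only [← map_sub] at e1 e2
      have e3 := h.norm_add_norm_le h₁ h₂ (hP (Θ n (x - y))) (hQ (Θ n (x - y))) n
      rw [hPQ, hΦΘ] at e3
      have e4 := h.up_add n j (P (Θ n (x - y)))
      have e5 := h.up_add n j (Q (Θ n (x - y)))
      calc _ = |(‖Φ (n + j) (P (Θ n x))‖ - ‖Φ (n + j) (P (Θ n y))‖) -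
            (‖Φ (n + j) (Q (Θ n x))‖ - ‖Φ (n + j) (Q (Θ n y))‖)| := by
              congr 1
              ring
        _ ≤ _ := abs_sub _ _
        _ ≤ ‖Φ (n + j) (P (Θ n (x - y)))‖ + ‖Φ (n + j) (Q (Θ n (x - y)))‖ := add_le_add e1 e2
        _ ≤ M ^ j * (‖Φ n (P (Θ n (x - y)))‖ + ‖Φ n (Q (Θ n (x - y)))‖) := by linarith
        _ ≤ M ^ T * (4 * M ^ T * ‖x - y‖) := by gcongr
        _ = _ := by ring
    simp only [G]
    rw [← Finset.sum_sub_distrib]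
    refine (Finset.abs_sum_le_sum_abs _ _).trans ((Finset.sum_le_sum hterm).trans ?_)
    rw [Finset.sum_const, Finset.card_range, nsmul_eq_mul, hCdef]
    exact le_of_eq (by ring)
  have hG0 : ∀ n, G n 0 = 0 := fun n => by simp [G]
  have hGbd : ∀ n x, |G n x| ≤ C * ‖x‖ := fun n x => by simpa [hG0] using hGlip n x 0
  have hstep : ∀ n x, G (n + 1) (Φ (n + 1) x) ≤ G n (Φ n x) - 1 / 2 * ‖Φ n x‖ := by
    intro n x
    rw [hGΦ, hGΦ]
    have e1 := Finset.sum_range_succ (fun j => ‖Φ (n + j) (P x)‖ - ‖Φ (n + j) (Q x)‖) T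
    have e2 := Finset.sum_range_succ' (fun j => ‖Φ (n + j) (P x)‖ - ‖Φ (n + j) (Q x)‖) T
    have e3 : ∑ j ∈ Finset.range T, (‖Φ (n + (j + 1)) (P x)‖ - ‖Φ (n + (j + 1)) (Q x)‖) =
        ∑ j ∈ Finset.range T, (‖Φ (n + 1 + j) (P x)‖ - ‖Φ (n + 1 + j) (Q x)‖) :=
      Finset.sum_congr rfl fun j _ => by rw [add_assoc, add_comm 1 j]
    simp only [e3, add_zero] at e2
    have e4 := h₁ _ (hP x) n
    have e5 := h₂ _ (hQ x) n
    have e6 : ‖Φ n x‖ ≤ ‖Φ n (P x)‖ + ‖Φ n (Q x)‖ := by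
      have := norm_add_le (Φ n (P x)) (Φ n (Q x))
      rwa [← map_add, hPQ] at this
    linarith [norm_nonneg (Φ n (Q x))]
  -- `G` drops at rate `1 / 2` along `Φ` and is `C`-Lipschitz, so this closeness leaves rate `1 / 4`
  -- along `Ψ`.
  have hη : 0 < 1 / (4 * C) := by positivity
  refine ⟨1 / (4 * C), hη, 1 + (1 / 4) / C, ?_, 2 * C / (1 / 4), by positivity, ?_⟩
  · have : 0 < 1 / 4 / C := by positivity
    linarith
  intro Ψ hΨ0 hΨinj hΨ
  refine ⟨boundedOrbits Ψ, isCompl_boundedOrbits_of_lyapunov (G := G) (F := fun n => L₁.map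
    (Φ n : E →ₗ[ℝ] E)) hΨinj (by norm_num) (by linarith) (fun n => ?_) hGbd (fun n x => ?_)
    ?_ (fun n => ?_) (fun y hy hy0 => ?_) (fun x => ?_)⟩
  · simp only [G]
    fun_prop
  · have e1 := hΨ n x (Θ n (Ψ n x)) (hΦΘ _ _).symm
    have e2 := hstep n (Θ n (Ψ n x))
    rw [hΦΘ] at e2
    have e3 := (abs_le.1 (hGlip (n + 1) (Ψ (n + 1) x) (Φ (n + 1) (Θ n (Ψ n x))))).2
    have e4 : C * ‖Ψ (n + 1) x - Φ (n + 1) (Θ n (Ψ n x))‖ ≤ 1 / 4 * ‖Ψ n x‖ := by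
      calc _ ≤ C * (1 / (4 * C) * ‖Ψ n x‖) := by gcongr
        _ = 1 / 4 * ‖Ψ n x‖ := by field_simp
    linarith
  · rintro n _ ⟨x, hx, rfl⟩
    rw [ContinuousLinearMap.coe_coe, hGΦ, hQ₁ x hx]
    exact Finset.sum_nonneg fun j _ => by simp
  · rw [← (Submodule.equivMapOfInjective (Φ n : E →ₗ[ℝ] E) (hΦinj n) L₁).finrank_eq]
    exact Submodule.finrank_add_eq_of_isCompl hL
  · have e : Ψ 0 y = Φ 0 y := by rw [hΨ0, h.zero]
    rw [e, hGΦ, hP₂ y hy, hQ₂ y hy]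
    have : 0 < ∑ j ∈ Finset.range T, ‖Φ (0 + j) y‖ :=
      Finset.sum_pos (fun j _ => h.norm_pos _ hy0) ⟨0, Finset.mem_range.2 hT⟩
    simpa using this
  · refine ⟨‖Q x‖ + ∑ j ∈ Finset.range T, ‖Φ (0 + j) (P x)‖, fun y hy h0 => ?_⟩
    have e : Ψ 0 (x - y) = Φ 0 (x - y) := by rw [hΨ0, h.zero]
    rw [e, hGΦ, map_sub, map_sub, hP₂ y hy, hQ₂ y hy, sub_zero, Finset.sum_sub_distrib] at h0
    have e1 : ‖Φ (0 + 0) (Q x - y)‖ ≤ ∑ j ∈ Finset.range T, ‖Φ (0 + j) (Q x - y)‖ :=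
      Finset.single_le_sum (f := fun j => ‖Φ (0 + j) (Q x - y)‖) (fun _ _ => norm_nonneg _)
        (Finset.mem_range.2 hT)
    simp only [add_zero, h.zero, ContinuousLinearMap.id_apply] at e1
    have e2 := norm_sub_norm_le y (Q x)
    rw [norm_sub_rev] at e2
    linarith

end Roughness

/-! ### Matrix sequences as tempered evolutions; openness of exponential dichotomy. -/

section Transition

variable {d : ℕ}

/-- The evolution of `x(n+1) = A(n) x(n)` from time `0` to time `n`. -/
noncomputable def transition (A : ℕ → Matrix (Fin d) (Fin d) ℝ) :
    ℕ → EuclideanSpace ℝ (Fin d) →L[ℝ] EuclideanSpace ℝ (Fin d)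
  | 0 => ContinuousLinearMap.id ℝ _
  | n + 1 => (Matrix.toEuclideanCLM (𝕜 := ℝ) (A n)).comp (transition A n)

lemma transition_succ_apply (A : ℕ → Matrix (Fin d) (Fin d) ℝ) (n : ℕ)
    (x : EuclideanSpace ℝ (Fin d)) :
    transition A (n + 1) x = Matrix.toEuclideanCLM (𝕜 := ℝ) (A n) (transition A n x) := rfl

lemma solution_eq_transition (A : ℕ → Matrix (Fin d) (Fin d) ℝ) (x : EuclideanSpace ℝ (Fin d))
    (n : ℕ) : solution A x n = transition A n x := by
  induction n with
  | zero => rfl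
  | succ n ih =>
    rw [transition_succ_apply, ← ih]
    rfl

lemma norm_toEuclideanCLM (A : Matrix (Fin d) (Fin d) ℝ) :
    ‖Matrix.toEuclideanCLM (𝕜 := ℝ) A‖ = ‖A‖ := (Matrix.l2_opNorm_def A).symm

lemma norm_toEuclideanCLM_apply_le (A : BddMatSeq d) (n : ℕ) (x : EuclideanSpace ℝ (Fin d)) :
    ‖Matrix.toEuclideanCLM (𝕜 := ℝ) (A n) x‖ ≤ ‖A‖ * ‖x‖ := by
  refine (ContinuousLinearMap.le_opNorm _ _).trans ?_
  rw [norm_toEuclideanCLM]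
  gcongr
  exact lp.norm_apply_le_norm ENNReal.top_ne_zero A n

/-- A uniform lower bound is easier to perturb than bounded inverses; in finite dimension the
injectivity it gives already yields invertibility. -/
lemma mem_lyapunovSet_iff (A : BddMatSeq d) : A ∈ lyapunovSet d ↔
    ∃ c > 0, ∀ n (x : EuclideanSpace ℝ (Fin d)),
      c * ‖x‖ ≤ ‖Matrix.toEuclideanCLM (𝕜 := ℝ) (A n) x‖ := by
  constructor
  · rintro ⟨hU, hB⟩
    obtain ⟨r, hr⟩ := memℓp_infty_iff.1 hB
    have hr' : ∀ n, ‖(A n)⁻¹‖ ≤ r := fun n => hr ⟨n, rfl⟩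
    refine ⟨(max r 1)⁻¹, by positivity, fun n x => ?_⟩
    rw [inv_mul_le_iff₀ (by positivity)]
    have h1 : Matrix.toEuclideanCLM (𝕜 := ℝ) ((A n)⁻¹)
        (Matrix.toEuclideanCLM (𝕜 := ℝ) (A n) x) = x := by
      rw [← mul_apply_eq_comp, ← map_mul,
        Matrix.nonsing_inv_mul _ ((Matrix.isUnit_iff_isUnit_det _).1 (hU n)), map_one]
      rfl
    calc ‖x‖ = ‖Matrix.toEuclideanCLM (𝕜 := ℝ) ((A n)⁻¹)
          (Matrix.toEuclideanCLM (𝕜 := ℝ) (A n) x)‖ := by rw [h1]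
      _ ≤ ‖Matrix.toEuclideanCLM (𝕜 := ℝ) ((A n)⁻¹)‖ * ‖Matrix.toEuclideanCLM (𝕜 := ℝ) (A n) x‖ :=
        ContinuousLinearMap.le_opNorm _ _
      _ ≤ _ := by
        rw [norm_toEuclideanCLM]
        gcongr
        exact (hr' n).trans (le_max_left _ _)
  · rintro ⟨c, hc, h⟩
    have hU : ∀ n, IsUnit (A n) := by
      intro n
      rw [← Matrix.mulVec_injective_iff_isUnit]
      intro x y hxy
      have h1 := h n (WithLp.toLp 2 (x - y))
      have h2 : Matrix.toEuclideanCLM (𝕜 := ℝ) (A n) (WithLp.toLp 2 (x - y)) = 0 := by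
        rw [Matrix.toEuclideanCLM_toLp, Matrix.mulVec_sub, hxy, sub_self]
        rfl
      rw [h2, norm_zero] at h1
      have h3 : ‖WithLp.toLp 2 (x - y)‖ ≤ 0 := by nlinarith [norm_nonneg (WithLp.toLp 2 (x - y))]
      have h4 := norm_le_zero_iff.1 h3
      exact sub_eq_zero.1 (congrArg WithLp.ofLp h4)
    refine ⟨hU, memℓp_infty_iff.2 ⟨c⁻¹, ?_⟩⟩
    rintro _ ⟨n, rfl⟩
    simp only
    rw [← norm_toEuclideanCLM]
    refine ContinuousLinearMap.opNorm_le_bound _ (by positivity) fun x => ?_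
    have h1 := h n (Matrix.toEuclideanCLM (𝕜 := ℝ) ((A n)⁻¹) x)
    rw [← mul_apply_eq_comp, ← map_mul,
      Matrix.mul_nonsing_inv _ ((Matrix.isUnit_iff_isUnit_det _).1 (hU n)), map_one] at h1
    rw [← div_eq_inv_mul, le_div_iff₀ hc, mul_comm]
    exact h1

lemma norm_sub_apply_le (A B : BddMatSeq d) (n : ℕ) (x : EuclideanSpace ℝ (Fin d)) :
    ‖Matrix.toEuclideanCLM (𝕜 := ℝ) (B n) x - Matrix.toEuclideanCLM (𝕜 := ℝ) (A n) x‖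
      ≤ ‖B - A‖ * ‖x‖ := by
  simpa using norm_toEuclideanCLM_apply_le (B - A) n x

lemma exists_forall_norm_sub_lt_mem_lyapunovSet {A : BddMatSeq d} (hA : A ∈ lyapunovSet d) :
    ∃ η > 0, ∀ B : BddMatSeq d, ‖B - A‖ < η → B ∈ lyapunovSet d := by
  obtain ⟨c, hc, h⟩ := (mem_lyapunovSet_iff A).1 hA
  refine ⟨c / 2, by positivity, fun B hB => (mem_lyapunovSet_iff B).2 ⟨c / 2, by positivity, ?_⟩⟩
  intro n x
  have h1 := norm_sub_apply_le A B n x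
  have h2 := h n x
  have h3 := norm_sub_norm_le (Matrix.toEuclideanCLM (𝕜 := ℝ) (A n) x)
    (Matrix.toEuclideanCLM (𝕜 := ℝ) (B n) x)
  rw [norm_sub_rev] at h3
  nlinarith [norm_nonneg x]

lemma exists_isTempered_transition {A : BddMatSeq d} (hA : A ∈ lyapunovSet d) :
    ∃ M, ‖A‖ ≤ M ∧ IsTempered (transition A) M := by
  obtain ⟨c, hc, h⟩ := (mem_lyapunovSet_iff A).1 hA
  refine ⟨max (max ‖A‖ c⁻¹) 1, (le_max_left _ _).trans (le_max_left _ _), rfl, le_max_right _ _,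
    fun n x => ?_, fun n x => ?_⟩
  · rw [transition_succ_apply]
    refine (norm_toEuclideanCLM_apply_le A n _).trans ?_
    gcongr
    exact (le_max_left _ _).trans (le_max_left _ _)
  · have h1 := h n (transition A n x)
    rw [mul_comm, ← le_div_iff₀ hc, div_eq_inv_mul] at h1
    refine h1.trans ?_
    rw [transition_succ_apply]
    gcongr
    exact (le_max_right _ _).trans (le_max_left _ _)

lemma IsTempered.injective {E : Type*} [NormedAddCommGroup E] [NormedSpace ℝ E]
    {Φ : ℕ → E →L[ℝ] E} {M : ℝ} (h : IsTempered Φ M) (n : ℕ) : Function.Injective (Φ n) := by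
  rw [injective_iff_map_eq_zero]
  intro x hx
  by_contra hx0
  exact (h.norm_pos n hx0).ne' (by rw [hx, norm_zero])

lemma HasExponentialDichotomy.hasBohlDichotomy {A : ℕ → Matrix (Fin d) (Fin d) ℝ}
    (h : HasExponentialDichotomy A) : HasBohlDichotomy A := by
  obtain ⟨L₁, L₂, hL, α, K, hα, hK, h₁, h₂⟩ := h
  exact ⟨L₁, L₂, hL, α, hα, fun _ => K, fun _ => K⁻¹, fun _ => hK, fun _ => inv_pos.2 hK, h₁, h₂⟩

/-- An exponential dichotomy from estimates with powers instead of exponentials. -/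
lemma hasExponentialDichotomy_of_pow {A : ℕ → Matrix (Fin d) (Fin d) ℝ}
    {L₁ L₂ : Submodule ℝ (EuclideanSpace ℝ (Fin d))} (hL : IsCompl L₁ L₂) {ρ K : ℝ} (hρ : 1 < ρ)
    (hK : 0 < K)
    (h₁ : ∀ x ∈ L₁, ∀ m k : ℕ, ρ ^ k * ‖transition A (m + k) x‖ ≤ K * ‖transition A m x‖)
    (h₂ : ∀ x ∈ L₂, ∀ m k : ℕ, ρ ^ k * ‖transition A m x‖ ≤ K * ‖transition A (m + k) x‖) :
    HasExponentialDichotomy A := by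
  have hρ0 : 0 < ρ := by linarith
  have hexp : ∀ m k : ℕ, Real.exp (Real.log ρ * (((m + k : ℕ) : ℝ) - m)) = ρ ^ k := by
    intro m k
    rw [Nat.cast_add, add_sub_cancel_left, mul_comm, Real.exp_nat_mul, Real.exp_log hρ0]
  refine ⟨L₁, L₂, hL, Real.log ρ, K, Real.log_pos hρ, hK, fun x hx m n hmn => ?_,
    fun x hx m n hmn => ?_⟩
  · obtain ⟨k, rfl⟩ := Nat.exists_eq_add_of_le hmn
    rw [solution_eq_transition, solution_eq_transition, neg_mul, Real.exp_neg, hexp]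
    have hρk : 0 < ρ ^ k := by positivity
    calc _ = (ρ ^ k)⁻¹ * (ρ ^ k * ‖transition A (m + k) x‖) := by field_simp
      _ ≤ (ρ ^ k)⁻¹ * (K * ‖transition A m x‖) := 
        mul_le_mul_of_nonneg_left (h₁ x hx m k) (inv_pos.2 hρk).le
      _ = _ := by ring
  · obtain ⟨k, rfl⟩ := Nat.exists_eq_add_of_le hmn
    rw [solution_eq_transition, solution_eq_transition, hexp]
    calc _ = K⁻¹ * (ρ ^ k * ‖transition A m x‖) := by ring
      _ ≤ K⁻¹ * (K * ‖transition A (m + k) x‖) := 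
        mul_le_mul_of_nonneg_left (h₂ x hx m k) (inv_pos.2 hK).le
      _ = _ := by field_simp

/-- Exponential dichotomy is an open property among bounded sequences. -/
lemma exists_forall_norm_sub_lt_hasExponentialDichotomy {A : BddMatSeq d}
    (hA : A ∈ lyapunovSet d) (hED : HasExponentialDichotomy fun n => A n) :
    ∃ η > 0, ∀ B : BddMatSeq d, ‖B - A‖ < η →
      B ∈ lyapunovSet d ∧ HasExponentialDichotomy fun n => B n := by
  obtain ⟨L₁, L₂, hL, α, K, hα, hK, h₁, h₂⟩ := hED
  obtain ⟨M, -, hM⟩ := exists_isTempered_transition hA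
  obtain ⟨η₁, hη₁, hB₁⟩ := exists_forall_norm_sub_lt_mem_lyapunovSet hA
  obtain ⟨T, hT⟩ := exists_nat_ge (max 1 (2 * K / α))
  have hT1 : 1 ≤ T := by exact_mod_cast (le_max_left _ _).trans hT
  have hTexp : 2 * K ≤ Real.exp (α * T) := by
    have h1 : 2 * K / α ≤ T := (le_max_right _ _).trans hT
    rw [div_le_iff₀ hα] at h1
    linarith [Real.add_one_le_exp (α * T)]
  have hsub : ∀ n : ℕ, ((n + T : ℕ) : ℝ) - n = T := fun n => by push_cast; ring
  obtain ⟨η₂, hη₂, ρ, hρ, K', hK', hrough⟩ := hM.exists_roughness hL hT1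
    (by
      intro x hx n
      have h3 := h₁ x hx n (n + T) (Nat.le_add_right _ _)
      rw [solution_eq_transition, solution_eq_transition, hsub, neg_mul, Real.exp_neg] at h3
      have h4 : K * (Real.exp (α * T))⁻¹ ≤ 1 / 2 := by
        rw [← div_eq_mul_inv, div_le_iff₀ (Real.exp_pos _)]
        linarith
      nlinarith [norm_nonneg (transition (fun n => A n) n x)])
    (by
      intro x hx n
      have h3 := h₂ x hx n (n + T) (Nat.le_add_right _ _)
      rw [solution_eq_transition, solution_eq_transition, hsub] at h3
      have h4 : 2 ≤ K⁻¹ * Real.exp (α * T) := by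
        rw [← div_eq_inv_mul, le_div_iff₀ hK]
        exact hTexp
      nlinarith [norm_nonneg (transition (fun n => A n) n x)])
  refine ⟨min η₁ η₂, lt_min hη₁ hη₂, fun B hB => ?_⟩
  have hBL := hB₁ B (hB.trans_le (min_le_left _ _))
  refine ⟨hBL, ?_⟩
  obtain ⟨M', -, hM'⟩ := exists_isTempered_transition hBL
  obtain ⟨L, hLL, h5, h6⟩ := hrough (transition B) rfl hM'.injective (by
    intro n x y hxy
    rw [transition_succ_apply, transition_succ_apply, ← hxy]
    refine (norm_sub_apply_le A B n _).trans ?_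
    gcongr
    exact hB.le.trans (min_le_right _ _))
  exact hasExponentialDichotomy_of_pow hLL hρ hK' h5 h6

end Transition

/-! ### Destroying a non-exponential Bohl dichotomy. -/

section Destruction

variable {d : ℕ}

/-- Event number `i` refutes any estimate with rate `α ≥ 1 / (i + 1)` and constant `C < ε * (i + 1)
/ 4`, hence every given estimate once `i` is large. -/
lemma exists_nat_forall_not_le {ε α C : ℝ} (hε : 0 < ε) (hα : 0 < α) (hC : 0 < C) (N : ℕ) :
    ∃ i : ℕ, N ≤ i ∧ ∀ s p q : ℝ, 0 ≤ s → 0 < p →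
      ε / 4 * (((i : ℝ) + 1) * Real.exp (-(1 / ((i : ℝ) + 1)) * s)) * p ≤ q →
      ¬ q ≤ C * Real.exp (-α * s) * p := by
  obtain ⟨i, hi⟩ := exists_nat_ge (max (N : ℝ) (max (1 / α) (4 * C / ε)))
  have h1 : (N : ℝ) ≤ i := (le_max_left _ _).trans hi
  have h2 : 1 / α ≤ i := (le_max_left _ _).trans ((le_max_right _ _).trans hi)
  have h3 : 4 * C / ε ≤ i := (le_max_right _ _).trans ((le_max_right _ _).trans hi)
  have hi0 : (0 : ℝ) ≤ i := Nat.cast_nonneg i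
  refine ⟨i, by exact_mod_cast h1, fun s p q hs hp hq hq' => ?_⟩
  have h4 : 1 / ((i : ℝ) + 1) ≤ α := by
    rw [div_le_iff₀ hα] at h2
    rw [div_le_iff₀ (by positivity)]
    linarith
  have h5 : C < ε / 4 * ((i : ℝ) + 1) := by
    rw [div_le_iff₀ hε] at h3
    linarith
  have h6 : Real.exp (-α * s) ≤ Real.exp (-(1 / ((i : ℝ) + 1)) * s) :=
    Real.exp_le_exp.2 (by nlinarith)
  set e := Real.exp (-(1 / ((i : ℝ) + 1)) * s) with he
  have he0 : 0 < e := Real.exp_pos _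
  have h7 : C * Real.exp (-α * s) * p ≤ C * e * p := by gcongr
  have h8 : C * e * p < ε / 4 * ((i : ℝ) + 1) * e * p := by gcongr
  linarith

/-- In a system with a Bohl dichotomy every solution either decays uniformly or eventually grows
uniformly. -/
lemma HasBohlDichotomy.decay_or_growth {A : ℕ → Matrix (Fin d) (Fin d) ℝ}
    (h : HasBohlDichotomy A) (x : EuclideanSpace ℝ (Fin d)) :
    (∃ α > 0, ∃ C > 0, ∀ m n : ℕ, m ≤ n →
      ‖solution A x n‖ ≤ C * Real.exp (-α * ((n : ℝ) - m)) * ‖solution A x m‖) ∨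
    (Filter.Tendsto (fun n => ‖solution A x n‖) Filter.atTop Filter.atTop ∧
      ∃ α > 0, ∃ C > 0, ∃ N : ℕ, ∀ m n : ℕ, N ≤ m → m ≤ n →
        C * Real.exp (α * ((n : ℝ) - m)) * ‖solution A x m‖ ≤ ‖solution A x n‖) := by
  obtain ⟨L₁, L₂, hL, α, hα, C₁, C₂, hC₁, hC₂, h₁, h₂⟩ := h
  obtain ⟨y, hy, z, hz, rfl⟩ :=
    Submodule.mem_sup.1 (hL.sup_eq_top ▸ Submodule.mem_top : x ∈ L₁ ⊔ L₂)
  by_cases hz0 : z = 0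
  · left
    rw [hz0, add_zero]
    exact ⟨α, hα, C₁ y, hC₁ y, h₁ y hy⟩
  right
  have hadd : ∀ n, solution A (y + z) n = solution A y n + solution A z n := fun n => by
    simp only [solution_eq_transition, map_add]
  have hexp : Filter.Tendsto (fun n : ℕ => α * (n : ℝ)) Filter.atTop Filter.atTop :=
    tendsto_natCast_atTop_atTop.const_mul_atTop hα
  have hylim : Filter.Tendsto (fun n => ‖solution A y n‖) Filter.atTop (nhds 0) := by
    refine squeeze_zero (fun _ => norm_nonneg _)
      (fun n => (h₁ y hy 0 n (Nat.zero_le n))) ?_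
    have h3 := (Real.tendsto_exp_neg_atTop_nhds_zero.comp hexp).const_mul (C₁ y)
    have h4 := h3.mul_const ‖solution A y 0‖
    simpa [Function.comp_def] using h4
  have hzlim : Filter.Tendsto (fun n => ‖solution A z n‖) Filter.atTop Filter.atTop := by
    have hz0' : 0 < ‖solution A z 0‖ := norm_pos_iff.2 hz0
    refine Filter.tendsto_atTop_mono (fun n => h₂ z hz 0 n (Nat.zero_le n)) ?_
    have h3 := ((Real.tendsto_exp_atTop.comp hexp).const_mul_atTop (hC₂ z)).atTop_mul_const hz0'
    simpa [Function.comp_def] using h3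
  -- From `N` on the decaying part is below half the growing part, so the sum has the norm of `z` up
  -- to a factor 2; growth holds only from there.
  obtain ⟨N, hN⟩ := Filter.eventually_atTop.1
    ((hylim.eventually (gt_mem_nhds one_half_pos)).and (hzlim.eventually_ge_atTop 1))
  have hlow : ∀ n ≥ N, 1 / 2 * ‖solution A z n‖ ≤ ‖solution A (y + z) n‖ := by
    intro n hn
    obtain ⟨h3, h4⟩ := hN n hn
    have h5 := norm_sub_norm_le (solution A z n) (-solution A y n)
    rw [sub_neg_eq_add, norm_neg, add_comm, ← hadd] at h5
    linarith
  have hup : ∀ n ≥ N, ‖solution A (y + z) n‖ ≤ 2 * ‖solution A z n‖ := by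
    intro n hn
    obtain ⟨h3, h4⟩ := hN n hn
    rw [hadd]
    linarith [norm_add_le (solution A y n) (solution A z n)]
  refine ⟨?_, α, hα, C₂ z / 4, by have := hC₂ z; positivity, N, fun m n hm hmn => ?_⟩
  · refine Filter.tendsto_atTop_mono' _ ?_ (hzlim.const_mul_atTop (one_half_pos (α := ℝ)))
    filter_upwards [Filter.eventually_ge_atTop N] with n hn using hlow n hn
  · have h3 := hC₂ z
    calc _ ≤ C₂ z / 4 * Real.exp (α * ((n : ℝ) - m)) * (2 * ‖solution A z m‖) := by
          gcongr
          exact hup m hm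
      _ = 1 / 2 * (C₂ z * Real.exp (α * ((n : ℝ) - m)) * ‖solution A z m‖) := by ring
      _ ≤ 1 / 2 * ‖solution A z n‖ := by
          gcongr
          exact h₂ z hz m n hmn
      _ ≤ _ := hlow n (hm.trans hmn)

/-- The orbit of a quasi-constant sequence is a solution of a nearby system. -/
lemma IsQuasiConstant.exists_bddMatSeq {A : BddMatSeq d} {M ε : ℝ}
    (h : IsTempered (transition A) M) (hAM : ‖A‖ ≤ M) (hε : 0 ≤ ε) (hε' : ε ≤ 1 / 2)
    {ξ : ℕ → EuclideanSpace ℝ (Fin d)} (hξ : IsQuasiConstant (transition A) ε ξ) (h0 : ξ 0 ≠ 0) :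
    ∃ B : BddMatSeq d, ‖B - A‖ ≤ M * ε ∧
      ∀ n, solution B (ξ 0) n = transition A n (ξ n) := by
  have hM := h.one_le
  set x : ℕ → EuclideanSpace ℝ (Fin d) := fun n => transition A n (ξ n) with hx
  have hxpos : ∀ n, 0 < ‖x n‖ := by
    intro n
    have h1 := hξ.norm_le_pow_mul h hε' n
    have h2 : 0 < ‖ξ 0‖ := norm_pos_iff.2 h0
    by_contra! hcon
    have h3 : ‖x n‖ = 0 := le_antisymm hcon (norm_nonneg _)
    simp only [hx] at h3
    rw [h3, mul_zero] at h1
    linarith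
  let r : ℕ → EuclideanSpace ℝ (Fin d) := fun n =>
    x (n + 1) - Matrix.toEuclideanCLM (𝕜 := ℝ) (A n) (x n)
  have hr : ∀ n, ‖r n‖ ≤ M * ε * ‖x n‖ := by
    intro n
    have h1 : r n = Matrix.toEuclideanCLM (𝕜 := ℝ) (A n)
        (transition A n (ξ (n + 1) - ξ n)) := by
      simp only [r, hx, transition_succ_apply, map_sub]
    rw [h1]
    refine (norm_toEuclideanCLM_apply_le A n _).trans ?_
    calc _ ≤ M * (ε * ‖x n‖) := by
          gcongr
          exact hξ n
      _ = _ := by ring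
  -- The rank-one map sending `x n` to the defect `r n` and killing its orthogonal complement has
  -- norm `‖r n‖ / ‖x n‖`.
  let D : ℕ → EuclideanSpace ℝ (Fin d) →L[ℝ] EuclideanSpace ℝ (Fin d) := fun n =>
    ((‖x n‖ ^ 2)⁻¹ • innerSL ℝ (x n)).smulRight (r n)
  have hDx : ∀ n, D n (x n) = r n := by
    intro n
    have := (hxpos n).ne'
    simp [D, this]
  have hD : ∀ n, ‖D n‖ ≤ M * ε := by
    intro n
    have h1 := hxpos n
    simp only [D]
    rw [ContinuousLinearMap.norm_smulRight_apply, norm_smul, innerSL_apply_norm, norm_inv,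
      norm_pow, norm_norm]
    calc _ ≤ (‖x n‖ ^ 2)⁻¹ * ‖x n‖ * (M * ε * ‖x n‖) := by
          gcongr
          exact hr n
      _ = M * ε := by field_simp
  let DM : ℕ → Matrix (Fin d) (Fin d) ℝ := fun n => (Matrix.toEuclideanCLM (𝕜 := ℝ)).symm (D n)
  have hDM : ∀ n, Matrix.toEuclideanCLM (𝕜 := ℝ) (DM n) = D n := fun n =>
    (Matrix.toEuclideanCLM (𝕜 := ℝ)).apply_symm_apply (D n)
  have hDMn : ∀ n, ‖DM n‖ ≤ M * ε := fun n => by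
    rw [← norm_toEuclideanCLM, hDM]
    exact hD n
  let Δ : BddMatSeq d := ⟨DM, memℓp_infty_iff.2 ⟨M * ε, by rintro _ ⟨n, rfl⟩; exact hDMn n⟩⟩
  refine ⟨A + Δ, ?_, fun n => ?_⟩
  · rw [add_sub_cancel_left]
    exact lp.norm_le_of_forall_le (by positivity) hDMn
  · induction n with
    | zero => rfl
    | succ n ih =>
      rw [solution_eq_transition] at ih ⊢
      rw [transition_succ_apply, ih]
      have h1 : (A + Δ) n = A n + DM n := rfl
      rw [h1, map_add, add_apply, hDM]
      change Matrix.toEuclideanCLM (𝕜 := ℝ) (A n) (x n) + D n (x n) = x (n + 1)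
      rw [hDx]
      simp [r]

/-- A dichotomy that is uniform on both subspaces is exponential. -/
lemma hasExponentialDichotomy_of_uniform {A : ℕ → Matrix (Fin d) (Fin d) ℝ}
    {L₁ L₂ : Submodule ℝ (EuclideanSpace ℝ (Fin d))} (hL : IsCompl L₁ L₂)
    (h₁ : ∃ K > 0, ∃ δ > 0, ∀ v ∈ L₁, ∀ a b : ℕ, a < b →
      ‖transition A b v‖ ≤ K * Real.exp (-δ * |(a : ℝ) - b|) * ‖transition A a v‖)
    (h₂ : ∃ K > 0, ∃ δ > 0, ∀ v ∈ L₂, ∀ a b : ℕ, b < a →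
      ‖transition A b v‖ ≤ K * Real.exp (-δ * |(a : ℝ) - b|) * ‖transition A a v‖) :
    HasExponentialDichotomy A := by
  obtain ⟨K₁, hK₁, δ₁, hδ₁, h₁⟩ := h₁
  obtain ⟨K₂, hK₂, δ₂, hδ₂, h₂⟩ := h₂
  set δ := min δ₁ δ₂ with hδ
  have hδ0 : 0 < δ := lt_min hδ₁ hδ₂
  set K := max (max K₁ K₂) 1 with hK
  have hK0 : 0 < K := by positivity
  have hK1 : K₁ ≤ K := (le_max_left _ _).trans (le_max_left _ _)
  have hK2 : K₂ ≤ K := (le_max_right _ _).trans (le_max_left _ _)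
  have hK3 : 1 ≤ K := le_max_right _ _
  refine ⟨L₁, L₂, hL, δ, K, hδ0, hK0, fun x hx m n hmn => ?_, fun x hx m n hmn => ?_⟩
  · rw [solution_eq_transition, solution_eq_transition]
    rcases hmn.eq_or_lt with rfl | hlt
    · simp only [sub_self, mul_zero, Real.exp_zero, mul_one]
      exact le_mul_of_one_le_left (norm_nonneg _) hK3
    · refine (h₁ x hx m n hlt).trans ?_
      have hmn' : (m : ℝ) ≤ n := by exact_mod_cast hmn
      rw [abs_sub_comm, abs_of_nonneg (by linarith)]
      gcongr
      exact min_le_left _ _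
  · rw [solution_eq_transition, solution_eq_transition]
    rcases hmn.eq_or_lt with rfl | hlt
    · simp only [sub_self, mul_zero, Real.exp_zero, mul_one]
      exact mul_le_of_le_one_left (norm_nonneg _) (inv_le_one_of_one_le₀ hK3)
    · have hmn' : (m : ℝ) ≤ n := by exact_mod_cast hmn
      have h3 : ‖transition A m x‖ ≤ K * Real.exp (-δ * ((n : ℝ) - m)) * ‖transition A n x‖ := by
        refine (h₂ x hx n m hlt).trans ?_
        rw [abs_of_nonneg (by linarith)]
        gcongr
        exact min_le_right _ _
      calc _ ≤ K⁻¹ * Real.exp (δ * ((n : ℝ) - m)) *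
            (K * Real.exp (-δ * ((n : ℝ) - m)) * ‖transition A n x‖) := by gcongr
        _ = (K⁻¹ * K) * (Real.exp (δ * ((n : ℝ) - m)) * Real.exp (-δ * ((n : ℝ) - m))) *
            ‖transition A n x‖ := by ring
        _ = ‖transition A n x‖ := by
          rw [← Real.exp_add, inv_mul_cancel₀ hK0.ne']
          simp

/-- A Bohl dichotomy that is not exponential can be destroyed by arbitrarily small perturbations. -/
theorem exists_not_hasBohlDichotomy {A : BddMatSeq d} (hA : A ∈ lyapunovSet d)
    (hBD : HasBohlDichotomy fun n => A n) (hED : ¬ HasExponentialDichotomy fun n => A n)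
    {ε : ℝ} (hε : 0 < ε) :
    ∃ B : BddMatSeq d, B ∈ lyapunovSet d ∧ ‖B - A‖ < ε ∧ ¬ HasBohlDichotomy fun n => B n := by
  obtain ⟨M, hAM, hM⟩ := exists_isTempered_transition hA
  obtain ⟨η, hη, hη'⟩ := exists_forall_norm_sub_lt_mem_lyapunovSet hA
  have hM1 := hM.one_le
  have hmin : 0 < min ε η := lt_min hε hη
  -- The perturbation has size at most `M * θ`, which must be below `ε` and below `η`, so that `B`
  -- stays a Lyapunov sequence.
  set θ := min (1 / 2) (min ε η / (2 * M)) with hθ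
  have hθ0 : 0 < θ := by positivity
  have hθ1 : θ ≤ 1 / 2 := min_le_left _ _
  have hMθ : M * θ < min ε η := by
    have h1 : θ ≤ min ε η / (2 * M) := min_le_right _ _
    rw [le_div_iff₀ (by positivity)] at h1
    linarith
  -- One bad orbit refutes a Bohl dichotomy of `B`, whatever `B` does elsewhere.
  suffices hξ : ∃ ξ, IsQuasiConstant (transition A) θ ξ ∧ ξ 0 ≠ 0 ∧
      ∀ B : BddMatSeq d, (∀ n, solution B (ξ 0) n = transition A n (ξ n)) →
        ¬ HasBohlDichotomy fun n => B n by
    obtain ⟨ξ, h1, h2, h3⟩ := hξ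
    obtain ⟨B, hB, hBsol⟩ := h1.exists_bddMatSeq hM hAM hθ0.le hθ1 h2
    have hlt := hB.trans_lt hMθ
    exact ⟨B, hη' B (hlt.trans_le (min_le_right _ _)), hlt.trans_le (min_le_left _ _), h3 B hBsol⟩
  have hpos : ∀ ξ, IsQuasiConstant (transition A) θ ξ → ξ 0 ≠ 0 →
      ∀ n, 0 < ‖transition A n (ξ n)‖ := by
    intro ξ hξ h0 n
    have h1 := hξ.norm_le_pow_mul hM hθ1 n
    have h2 : 0 < ‖ξ 0‖ := norm_pos_iff.2 h0
    exact pos_of_mul_pos_right (h2.trans_le h1) (by positivity)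
  obtain ⟨L₁, L₂, hL, α, hα, C₁, C₂, hC₁, hC₂, h₁, h₂⟩ := hBD
  have hexp : Filter.Tendsto (fun n : ℕ => α * (n : ℝ)) Filter.atTop Filter.atTop :=
    tendsto_natCast_atTop_atTop.const_mul_atTop hα
  by_cases hu₁ : ∃ K > 0, ∃ δ > 0, ∀ v ∈ L₁, ∀ a b : ℕ, a < b →
      ‖transition A b v‖ ≤ K * Real.exp (-δ * |(a : ℝ) - b|) * ‖transition A a v‖
  · have hu₂ : ¬ ∃ K > 0, ∃ δ > 0, ∀ v ∈ L₂, ∀ a b : ℕ, b < a →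
      ‖transition A b v‖ ≤ K * Real.exp (-δ * |(a : ℝ) - b|) * ‖transition A a v‖ := fun hu₂ =>
        hED (hasExponentialDichotomy_of_uniform hL hu₁ hu₂)
    push Not at hu₂
    obtain ⟨ξ, h3, h4, h5, h6⟩ := hM.exists_not_growing hθ0 hθ1 (L := L₂)
      (by
        intro x hx hx0
        simp only [← solution_eq_transition]
        have hx0' : 0 < ‖solution A x 0‖ := norm_pos_iff.2 hx0
        refine Filter.tendsto_atTop_mono (fun n => h₂ x hx 0 n (Nat.zero_le n)) ?_
        have h3 := ((Real.tendsto_exp_atTop.comp hexp).const_mul_atTop (hC₂ x)).atTop_mul_const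
          hx0'
        simpa [Function.comp_def] using h3)
      (by
        intro K hK δ hδ
        obtain ⟨v, hv, a, b, hab, hlt⟩ := hu₂ K hK δ hδ
        exact ⟨v, hv, a, b, hab, hlt⟩)
    refine ⟨ξ, h3, h4, fun B hB hBB => ?_⟩
    have hp := hpos ξ h3 h4
    -- The orbit is unbounded, which excludes decay; events later than `N` exclude eventual growth.
    rcases hBB.decay_or_growth (ξ 0) with ⟨β, hβ, C, hC, hdec⟩ | ⟨-, β, hβ, C, hC, N, hgr⟩
    · simp only [hB] at hdec
      obtain ⟨i, hi⟩ := exists_nat_ge C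
      obtain ⟨t, ht⟩ := h5 i
      have h7 := hdec 0 t (Nat.zero_le t)
      have h8 : Real.exp (-β * ((t : ℝ) - (0 : ℕ))) ≤ 1 := by
        rw [Real.exp_le_one_iff]
        have : (0 : ℝ) ≤ t := Nat.cast_nonneg t
        simp only [Nat.cast_zero, sub_zero]
        nlinarith
      have h9 : ‖transition A t (ξ t)‖ ≤ C * 1 * ‖ξ 0‖ := h7.trans (by
        change C * _ * ‖ξ 0‖ ≤ _
        gcongr)
      have : 0 < ‖ξ 0‖ := norm_pos_iff.2 h4
      nlinarith
    · simp only [hB] at hgr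
      obtain ⟨i, hiN, hi⟩ := exists_nat_forall_not_le hθ0 hβ (inv_pos.2 hC) N
      obtain ⟨a, b, hib, hba, hev⟩ := h6 i
      have hba' : (b : ℝ) < a := by exact_mod_cast hba
      refine hi _ _ _ (abs_nonneg _) (hp a) hev ?_
      rw [abs_of_pos (by linarith)]
      have h7 := hgr b a (hiN.trans hib) hba.le
      calc ‖transition A b (ξ b)‖ = C⁻¹ * Real.exp (-β * ((a : ℝ) - b)) *
            (C * Real.exp (β * ((a : ℝ) - b)) * ‖transition A b (ξ b)‖) := by
            rw [neg_mul, Real.exp_neg]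
            field_simp
        _ ≤ _ := by gcongr
  · push Not at hu₁
    obtain ⟨ξ, h3, h4, h5, h6⟩ := hM.exists_not_decaying hθ0 hθ1 (L := L₁)
      (by
        intro x hx
        simp only [← solution_eq_transition]
        refine squeeze_zero (fun _ => norm_nonneg _)
          (fun n => (h₁ x hx 0 n (Nat.zero_le n))) ?_
        have h3 := (Real.tendsto_exp_neg_atTop_nhds_zero.comp hexp).const_mul (C₁ x)
        have h4 := h3.mul_const ‖solution A x 0‖
        simpa [Function.comp_def] using h4)
      (by
        intro K hK δ hδ
        obtain ⟨v, hv, a, b, hab, hlt⟩ := hu₁ K hK δ hδ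
        exact ⟨v, hv, a, b, hab, hlt⟩)
    refine ⟨ξ, h3, h4, fun B hB hBB => ?_⟩
    have hp := hpos ξ h3 h4
    -- The events exclude uniform decay; the returns below `‖ξ 0‖` at arbitrarily late times exclude
    -- divergence to infinity.
    rcases hBB.decay_or_growth (ξ 0) with ⟨β, hβ, C, hC, hdec⟩ | ⟨hlim, -⟩
    · simp only [hB] at hdec
      obtain ⟨i, -, hi⟩ := exists_nat_forall_not_le hθ0 hβ hC 0
      obtain ⟨a, b, -, hab, hev⟩ := h6 i
      have hab' : (a : ℝ) < b := by exact_mod_cast hab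
      refine hi _ _ _ (abs_nonneg _) (hp a) hev ?_
      rw [abs_sub_comm, abs_of_pos (by linarith)]
      exact hdec a b hab.le
    · simp only [hB] at hlim
      obtain ⟨N, hN⟩ := Filter.eventually_atTop.1 (hlim.eventually_gt_atTop ‖ξ 0‖)
      obtain ⟨t, ht, h7⟩ := h5 N
      exact (hN t ht).not_ge h7

end Destruction

/-- The interior of `BD^d` is `ED^d`, both in the space of Lyapunov sequences and in the ambient
space of bounded sequences; and every system in `BD^d \ ED^d` is a limit of systems without a
Bohl dichotomy. -/
theorem mainTheorem1 (d : ℕ) :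
    interior (BD d) = ED d ∧
    interior ((Subtype.val : LyapunovSeq d → BddMatSeq d) '' BD d) =
      (Subtype.val : LyapunovSeq d → BddMatSeq d) '' ED d ∧
    ∀ A ∈ BD d \ ED d, ∀ ε : ℝ, 0 < ε →
      ∃ B : LyapunovSeq d, ‖B.1 - A.1‖ < ε ∧ B ∉ BD d := by
  have hsub : ED d ⊆ BD d := fun A hA => HasExponentialDichotomy.hasBohlDichotomy hA
  have hdes : ∀ A ∈ BD d \ ED d, ∀ ε : ℝ, 0 < ε →
      ∃ B : LyapunovSeq d, ‖B.1 - A.1‖ < ε ∧ B ∉ BD d := by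
    rintro A ⟨hBD, hED⟩ ε hε
    obtain ⟨B, hB, hlt, hnot⟩ := exists_not_hasBohlDichotomy A.2 hBD hED hε
    exact ⟨⟨B, hB⟩, hlt, hnot⟩
  have hopen : IsOpen ((Subtype.val : LyapunovSeq d → BddMatSeq d) '' ED d) := by
    rw [Metric.isOpen_iff]
    rintro _ ⟨A, hA, rfl⟩
    obtain ⟨η, hη, h⟩ := exists_forall_norm_sub_lt_hasExponentialDichotomy A.2 hA
    refine ⟨η, hη, fun B hB => ?_⟩
    rw [Metric.mem_ball, dist_eq_norm] at hB
    obtain ⟨h1, h2⟩ := h B hB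
    exact ⟨⟨B, h1⟩, h2, rfl⟩
  refine ⟨Subset.antisymm ?_ ?_, Subset.antisymm ?_ ?_, hdes⟩
  · intro A hA
    by_contra hAED
    obtain ⟨ε, hε, hball⟩ := Metric.mem_nhds_iff.1 (mem_interior_iff_mem_nhds.1 hA)
    obtain ⟨B, hB, hnot⟩ := hdes A ⟨interior_subset hA, hAED⟩ ε hε
    refine hnot (hball ?_)
    rwa [Metric.mem_ball, Subtype.dist_eq, dist_eq_norm]
  · refine interior_maximal hsub ?_
    rw [← Subtype.val_injective.preimage_image (ED d)]
    exact hopen.preimage continuous_subtype_val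
  · intro A' hA
    obtain ⟨A, hABD, rfl⟩ := interior_subset hA
    refine ⟨A, ?_, rfl⟩
    by_contra hAED
    obtain ⟨ε, hε, hball⟩ := Metric.mem_nhds_iff.1 (mem_interior_iff_mem_nhds.1 hA)
    obtain ⟨B, hB, hnot⟩ := hdes A ⟨hABD, hAED⟩ ε hε
    have hB' : B.1 ∈ Subtype.val '' BD d := hball (by rwa [Metric.mem_ball, dist_eq_norm])
    exact hnot ((Subtype.val_injective.mem_set_image).1 hB')
  · exact interior_maximal (image_mono hsub) hopen
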